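/- Let $\mathsf{At}$ be a set of atoms. Formulae are $A,B ::= X \mid \mathsf I \mid A\otimes B\mid A\wedge B\mid A\vee B$ with $X\in\mathsf{At}$. A sequent $S\mid\Gamma\vdash A$ consists of a stoup $S$ (empty, written $-$, or one formula), a finite list $\Gamma$ of formulae and a formula $A$. **Derivations** are generated by the rules: $\mathsf{ax}$: $A\mid\ \vdash A$; $\mathsf{IR}$: $-\mid\ \vdash\mathsf I$; $\mathsf{pass}$: from $A\mid\Gamma\vdash C$ infer $-\mid A,\Gamma\vdash C$; $\mathsf{IL}$: from $-\mid\Gamma\vdash C$ infer $\mathsf I\mid\Gamma\vdash C$; $\otimes\mathsf L$: from $A\mid B,\Gamma\vdash C$ infer $A\otimes B\mid\Gamma\vdash C$; $\otimes\mathsf R$: from $S\mid\Gamma\vdash A$ and $-\mid\Delta\vdash B$ infer $S\mid\Gamma,\Delta\vdash A\otimes B$; $\wedge\mathsf L_i$ ($i=1,2$): from $A_i\mid\Gamma\vdash C$ infer $A_1\wedge A_2\mid\Gamma\vdash C$; $\wedge\mathsf R$: from $S\mid\Gamma\vdash A$ and $S\mid\Gamma\vdash B$ infer $S\mid\Gamma\vdash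 A\wedge B$; $\vee\mathsf L$: from $A\mid\Gamma\vdash C$ and $B\mid\Gamma\vdash C$ infer $A\vee B\mid\Gamma\vdash C$; $\vee\mathsf R_i$: from $S\mid\Gamma\vdash A_i$ infer $S\mid\Gamma\vdash A_1\vee A_2$. **The congruence** $\circeq$ is the least equivalence relation on derivations of the same sequent that is compatible with all the rules and contains the $\eta$-conversions $\mathsf{ax}_{\mathsf I}\circeq\mathsf{IL}\,\mathsf{IR}$, $\mathsf{ax}_{A\otimes B}\circeq\otimes\mathsf L(\otimes\mathsf R(\mathsf{ax}_A,\mathsf{pass}\,\mathsf{ax}_B))$, $\mathsf{ax}_{A\wedge B}\circeq\wedge\mathsf R(\wedge\mathsf L_1\mathsf{ax}_A,\wedge\mathsf L_2\mathsf{ax}_B)$, $\mathsf{ax}_{A\vee B}\circeq\vee\mathsf L(\vee\mathsf R_1\mathsf{ax}_A,\vee\mathsf R_2\mathsf{ax}_B)$ and the following permutations, where $\lambda$ ranges over the one-premise left rules $\mathsf{pass},\mathsf{IL},\otimes\mathsf L,\wedge\mathsf L_1,\wedge\mathsf L_2$ and $i\in\{1,2\}$: $\otimes\mathsf R(\lambda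 f,g)\circeq\lambda(\otimes\mathsf R(f,g))$, $\otimes\mathsf R(\vee\mathsf L(f_1,f_2),g)\circeq\vee\mathsf L(\otimes\mathsf R(f_1,g),\otimes\mathsf R(f_2,g))$, $\lambda(\wedge\mathsf R(f,g))\circeq\wedge\mathsf R(\lambda f,\lambda g)$, $\vee\mathsf L(\wedge\mathsf R(f_1,g_1),\wedge\mathsf R(f_2,g_2))\circeq\wedge\mathsf R(\vee\mathsf L(f_1,f_2),\vee\mathsf L(g_1,g_2))$, $\vee\mathsf R_i(\lambda f)\circeq\lambda(\vee\mathsf R_i f)$, $\vee\mathsf R_i(\vee\mathsf L(f,g))\circeq\vee\mathsf L(\vee\mathsf R_i f,\vee\mathsf R_i g)$. **Focused derivations.** There are four tags $\mathbb P,\mathbb C_1,\mathbb C_2,\mathbb R$. A list $l$ of tags is valid if it is non-empty and either $\mathbb R\in l$ or both $\mathbb C_1,\mathbb C_2\in l$. Below, $P$ is a formula whose principal connective is not $\wedge$; $T$ is a stoup that is empty, an atom or a conjunction; $x?$ means that the sequent is either untagged or tagged with $x$ ($l$ for lists of tags, $t$ for single tags), the same choice being made throughout a rule. The rules are those above with the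 following phases and tags. - Phase $\mathsf{RI}$. $\wedge\mathsf R$: from $S\mid\Gamma\vdash^{l_1?}_{\mathsf{RI}}A$ and $S\mid\Gamma\vdash^{l_2?}_{\mathsf{RI}}B$ infer $S\mid\Gamma\vdash^{l_1,l_2?}_{\mathsf{RI}}A\wedge B$; $\mathsf{LI2RI}$: from $S\mid\Gamma\vdash^{t?}_{\mathsf{LI}}P$ infer $S\mid\Gamma\vdash^{t?}_{\mathsf{RI}}P$. - Phase $\mathsf{LI}$. $\mathsf{IL},\otimes\mathsf L,\vee\mathsf L$, with succedent $P$, all premises and the conclusion untagged in $\vdash_{\mathsf{LI}}$; $\mathsf{F2LI}$: from $T\mid\Gamma\vdash^{t?}_{\mathsf F}P$ infer $T\mid\Gamma\vdash^{t?}_{\mathsf{LI}}P$. - Phase $\mathsf F$. $\mathsf{pass}$, $\wedge\mathsf L_1$, $\wedge\mathsf L_2$, with succedent $P$, untagged premise in $\vdash_{\mathsf{LI}}$ and conclusion in $\vdash^{\mathbb P?}_{\mathsf F}$, $\vdash^{\mathbb C_1?}_{\mathsf F}$, $\vdash^{\mathbb C_2?}_{\mathsf F}$ respectively; $\mathsf{ax}$: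 $X\mid\ \vdash^{\mathbb R?}_{\mathsf F}X$ ($X$ an atom); $\mathsf{IR}$: $-\mid\ \vdash^{\mathbb R?}_{\mathsf F}\mathsf I$; $\otimes\mathsf R$: from $T\mid\Gamma\vdash^{l}_{\mathsf{RI}}A$ with $l$ valid and $-\mid\Delta\vdash_{\mathsf{RI}}B$ infer $T\mid\Gamma,\Delta\vdash^{\mathbb R?}_{\mathsf F}A\otimes B$; $\vee\mathsf R_i$: from $T\mid\Gamma\vdash^{l}_{\mathsf{RI}}A_i$ with $l$ valid infer $T\mid\Gamma\vdash^{\mathbb R?}_{\mathsf F}A_1\vee A_2$. **The maps.** $\mathsf{emb}_{\mathsf{RI}}$ sends a derivation of $S\mid\Gamma\vdash_{\mathsf{RI}}A$ to the derivation of $S\mid\Gamma\vdash A$ obtained by erasing the phase switches and the tags. $\mathsf{focus}$ sends a derivation of $S\mid\Gamma\vdash A$ to a derivation of $S\mid\Gamma\vdash_{\mathsf{RI}}A$; it is defined by structural recursion and replaces each rule by an operation on untagged $\mathsf{RI}$-derivations: - $\wedge\mathsf R$ and $\mathsf{IR}$ are sent to the rules of the same name (for $\mathsf{IR}$, followed by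 phase switches). $\mathsf{pass},\mathsf{IL},\otimes\mathsf L,\wedge\mathsf L_i,\vee\mathsf L$ are applied above all the final $\wedge\mathsf R$ rules, to the $\mathsf{LI}$-derivations found there (for $\mathsf{pass}$ and $\wedge\mathsf L_i$ followed by $\mathsf{F2LI}$). $\mathsf{ax}_A$ is expanded along the $\eta$-conversions down to atoms. - For a right rule $\rho\in\{\otimes\mathsf R,\vee\mathsf R_1,\vee\mathsf R_2\}$, write the (left) premise as $\wedge\mathsf R$ rules applied to a list $f_1,\dots,f_n$ of $\mathsf{LI}$-derivations. If the $f_j$ end with a left invertible rule (the same for all $j$), that rule is moved below $\rho$ and one recurs. Otherwise all $f_j$ end with $\mathsf{F2LI}$; to each $j$ assign the tag $\mathbb P,\mathbb C_1,\mathbb C_2$ or $\mathbb R$ according to whether the rule above it is $\mathsf{pass}$, $\wedge\mathsf L_1$, $\wedge\mathsf L_2$ or another one. If the resulting list of tags is valid, apply the rule $\rho$ of phase $\mathsf F$ to the premise tagged with it; if not, all $f_j$ use the same left rule, which is moved below $\rho$, and one recurs. **Theorem.** For every sequent $S\mid\Gamma\vdash A$: 1. for all derivations $f,g$ of $S\mid\Gamma\vdash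 A$, if $f\circeq g$ then $\mathsf{focus}\,f=\mathsf{focus}\,g$; 2. for every derivation $f$ of $S\mid\Gamma\vdash A$, $\mathsf{emb}_{\mathsf{RI}}(\mathsf{focus}\,f)\circeq f$; 3. for every derivation $f$ of $S\mid\Gamma\vdash_{\mathsf{RI}}A$, $\mathsf{focus}(\mathsf{emb}_{\mathsf{RI}}\,f)=f$; 4. $\mathsf{focus}$ and $\mathsf{emb}_{\mathsf{RI}}$ induce mutually inverse bijections between the set of derivations of $S\mid\Gamma\vdash A$ modulo $\circeq$ and the set of (untagged) derivations of $S\mid\Gamma\vdash_{\mathsf{RI}}A$; 5. hence focused derivations are normal forms: every derivation $f$ of $S\mid\Gamma\vdash A$ is $\circeq$-equivalent to $\mathsf{emb}_{\mathsf{RI}}\,h$ for exactly one derivation $h$ of $S\mid\Gamma\vdash_{\mathsf{RI}}A$; 6. and $f\circeq g$ if and only if $\mathsf{focus}\,f=\mathsf{focus}\,g$. -/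

import Mathlib

universe u

namespace SkewAdd

/-- Formulae over a set `At` of atoms: `X`, `I`, `A ⊗ B`, `A ∧ B`, `A ∨ B`. -/
inductive Fma (At : Type u) : Type u
  | atom (X : At) : Fma At
  | unit : Fma At
  | tensor (A B : Fma At) : Fma At
  | and (A B : Fma At) : Fma At
  | or (A B : Fma At) : Fma At

/-- A stoup is empty (`none`) or a single formula. -/
abbrev Stoup (At : Type u) : Type u := Option (Fma At)

/-- A context is an ordered list of formulae. -/
abbrev Cxt (At : Type u) : Type u := List (Fma At)

variable {At : Type u}

/-! ### The sequent calculus -/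

/-- Derivations of `S ∣ Γ ⊢ A`.  In the right tensor rule the splitting of the context is
recorded by an equation, which is proof-irrelevant. -/
inductive Der : Stoup At → Cxt At → Fma At → Type u
  | ax {A : Fma At} : Der (some A) [] A
  | pass {A : Fma At} {Γ : Cxt At} {C : Fma At} :
      Der (some A) Γ C → Der none (A :: Γ) C
  | IL {Γ : Cxt At} {C : Fma At} : Der none Γ C → Der (some .unit) Γ C
  | IR : Der none [] .unit
  | tensorL {A B : Fma At} {Γ : Cxt At} {C : Fma At} :
      Der (some A) (B :: Γ) C → Der (some (.tensor A B)) Γ C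
  | tensorR {S : Stoup At} {Γ Δ Θ : Cxt At} {A B : Fma At} (h : Θ = Γ ++ Δ) :
      Der S Γ A → Der none Δ B → Der S Θ (.tensor A B)
  | andL₁ {A B : Fma At} {Γ : Cxt At} {C : Fma At} :
      Der (some A) Γ C → Der (some (.and A B)) Γ C
  | andL₂ {A B : Fma At} {Γ : Cxt At} {C : Fma At} :
      Der (some B) Γ C → Der (some (.and A B)) Γ C
  | andR {S : Stoup At} {Γ : Cxt At} {A B : Fma At} :
      Der S Γ A → Der S Γ B → Der S Γ (.and A B)
  | orL {A B : Fma At} {Γ : Cxt At} {C : Fma At} :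
      Der (some A) Γ C → Der (some B) Γ C → Der (some (.or A B)) Γ C
  | orR₁ {S : Stoup At} {Γ : Cxt At} {A B : Fma At} : Der S Γ A → Der S Γ (.or A B)
  | orR₂ {S : Stoup At} {Γ : Cxt At} {A B : Fma At} : Der S Γ B → Der S Γ (.or A B)

/-- The congruence `≗` on derivations: the least equivalence relation that is compatible with
all the inference rules and contains the eta-conversions and the permutative conversions. -/
inductive Cong : {S : Stoup At} → {Γ : Cxt At} → {A : Fma At} → Der S Γ A → Der S Γ A → Prop
  -- equivalence relation
  | refl {S : Stoup At} {Γ : Cxt At} {A : Fma At} (f : Der S Γ A) : Cong f f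
  | symm {S : Stoup At} {Γ : Cxt At} {A : Fma At} {f g : Der S Γ A} : Cong f g → Cong g f
  | trans {S : Stoup At} {Γ : Cxt At} {A : Fma At} {f g h : Der S Γ A} :
      Cong f g → Cong g h → Cong f h
  -- compatibility with the rules
  | pass {A' : Fma At} {Γ : Cxt At} {A : Fma At} {f g : Der (some A') Γ A} :
      Cong f g → Cong (.pass f) (.pass g)
  | IL {Γ : Cxt At} {A : Fma At} {f g : Der none Γ A} : Cong f g → Cong (.IL f) (.IL g)
  | tensorL {A' B' : Fma At} {Γ : Cxt At} {A : Fma At} {f g : Der (some A') (B' :: Γ) A} :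
      Cong f g → Cong (.tensorL f) (.tensorL g)
  | tensorR {S : Stoup At} {Γ Δ Θ : Cxt At} {A B : Fma At} (h : Θ = Γ ++ Δ)
      {f f' : Der S Γ A} {g g' : Der none Δ B} :
      Cong f f' → Cong g g' → Cong (.tensorR h f g) (.tensorR h f' g')
  | andL₁ {A' B' : Fma At} {Γ : Cxt At} {A : Fma At} {f g : Der (some A') Γ A} :
      Cong f g → Cong (.andL₁ (B := B') f) (.andL₁ g)
  | andL₂ {A' B' : Fma At} {Γ : Cxt At} {A : Fma At} {f g : Der (some B') Γ A} :
      Cong f g → Cong (.andL₂ (A := A') f) (.andL₂ g)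
  | andR {S : Stoup At} {Γ : Cxt At} {A B : Fma At} {f f' : Der S Γ A} {g g' : Der S Γ B} :
      Cong f f' → Cong g g' → Cong (.andR f g) (.andR f' g')
  | orL {A' B' : Fma At} {Γ : Cxt At} {A : Fma At}
      {f f' : Der (some A') Γ A} {g g' : Der (some B') Γ A} :
      Cong f f' → Cong g g' → Cong (.orL f g) (.orL f' g')
  | orR₁ {S : Stoup At} {Γ : Cxt At} {A B : Fma At} {f g : Der S Γ A} :
      Cong f g → Cong (.orR₁ (B := B) f) (.orR₁ g)
  | orR₂ {S : Stoup At} {Γ : Cxt At} {A B : Fma At} {f g : Der S Γ B} :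
      Cong f g → Cong (.orR₂ (A := A) f) (.orR₂ g)
  -- eta-conversions
  | ax_unit : Cong .ax (.IL .IR)
  | ax_tensor {A B : Fma At} :
      Cong .ax (.tensorL (.tensorR (Γ := []) (Δ := [B]) rfl (.ax (A := A)) (.pass .ax)))
  | ax_and {A B : Fma At} : Cong .ax (.andR (.andL₁ (.ax (A := A))) (.andL₂ (.ax (A := B))))
  | ax_or {A B : Fma At} : Cong .ax (.orL (.orR₁ (.ax (A := A))) (.orR₂ (.ax (A := B))))
  -- permutations of the right tensor rule
  | tensorR_pass {A' : Fma At} {Γ Δ : Cxt At} {A B : Fma At}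
      (f : Der (some A') Γ A) (g : Der none Δ B) :
      Cong (.tensorR (Γ := A' :: Γ) rfl (.pass f) g) (.pass (.tensorR rfl f g))
  | tensorR_IL {Γ Δ : Cxt At} {A B : Fma At} (f : Der none Γ A) (g : Der none Δ B) :
      Cong (.tensorR rfl (.IL f) g) (.IL (.tensorR rfl f g))
  | tensorR_tensorL {A' B' : Fma At} {Γ Δ : Cxt At} {A B : Fma At}
      (f : Der (some A') (B' :: Γ) A) (g : Der none Δ B) :
      Cong (.tensorR rfl (.tensorL f) g) (.tensorL (.tensorR (Γ := B' :: Γ) rfl f g))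
  | tensorR_andL₁ {A' B' : Fma At} {Γ Δ : Cxt At} {A B : Fma At}
      (f : Der (some A') Γ A) (g : Der none Δ B) :
      Cong (.tensorR rfl (.andL₁ (B := B') f) g) (.andL₁ (.tensorR rfl f g))
  | tensorR_andL₂ {A' B' : Fma At} {Γ Δ : Cxt At} {A B : Fma At}
      (f : Der (some B') Γ A) (g : Der none Δ B) :
      Cong (.tensorR rfl (.andL₂ (A := A') f) g) (.andL₂ (.tensorR rfl f g))
  | tensorR_orL {A' B' : Fma At} {Γ Δ : Cxt At} {A B : Fma At}
      (f₁ : Der (some A') Γ A) (f₂ : Der (some B') Γ A) (g : Der none Δ B) :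
      Cong (.tensorR rfl (.orL f₁ f₂) g) (.orL (.tensorR rfl f₁ g) (.tensorR rfl f₂ g))
  -- permutations of the right conjunction rule
  | pass_andR {A' : Fma At} {Γ : Cxt At} {A B : Fma At}
      (f : Der (some A') Γ A) (g : Der (some A') Γ B) :
      Cong (.pass (.andR f g)) (.andR (.pass f) (.pass g))
  | IL_andR {Γ : Cxt At} {A B : Fma At} (f : Der none Γ A) (g : Der none Γ B) :
      Cong (.IL (.andR f g)) (.andR (.IL f) (.IL g))
  | tensorL_andR {A' B' : Fma At} {Γ : Cxt At} {A B : Fma At}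
      (f : Der (some A') (B' :: Γ) A) (g : Der (some A') (B' :: Γ) B) :
      Cong (.tensorL (.andR f g)) (.andR (.tensorL f) (.tensorL g))
  | andL₁_andR {A' B' : Fma At} {Γ : Cxt At} {A B : Fma At}
      (f : Der (some A') Γ A) (g : Der (some A') Γ B) :
      Cong (.andL₁ (B := B') (.andR f g)) (.andR (.andL₁ f) (.andL₁ g))
  | andL₂_andR {A' B' : Fma At} {Γ : Cxt At} {A B : Fma At}
      (f : Der (some B') Γ A) (g : Der (some B') Γ B) :
      Cong (.andL₂ (A := A') (.andR f g)) (.andR (.andL₂ f) (.andL₂ g))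
  | orL_andR {A' B' : Fma At} {Γ : Cxt At} {A B : Fma At}
      (f₁ : Der (some A') Γ A) (f₂ : Der (some B') Γ A)
      (g₁ : Der (some A') Γ B) (g₂ : Der (some B') Γ B) :
      Cong (.orL (.andR f₁ g₁) (.andR f₂ g₂)) (.andR (.orL f₁ f₂) (.orL g₁ g₂))
  -- permutations of the right disjunction rules
  | orR₁_pass {A' : Fma At} {Γ : Cxt At} {A B : Fma At} (f : Der (some A') Γ A) :
      Cong (.orR₁ (B := B) (.pass f)) (.pass (.orR₁ f))
  | orR₂_pass {A' : Fma At} {Γ : Cxt At} {A B : Fma At} (f : Der (some A') Γ B) :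
      Cong (.orR₂ (A := A) (.pass f)) (.pass (.orR₂ f))
  | orR₁_IL {Γ : Cxt At} {A B : Fma At} (f : Der none Γ A) :
      Cong (.orR₁ (B := B) (.IL f)) (.IL (.orR₁ f))
  | orR₂_IL {Γ : Cxt At} {A B : Fma At} (f : Der none Γ B) :
      Cong (.orR₂ (A := A) (.IL f)) (.IL (.orR₂ f))
  | orR₁_tensorL {A' B' : Fma At} {Γ : Cxt At} {A B : Fma At}
      (f : Der (some A') (B' :: Γ) A) :
      Cong (.orR₁ (B := B) (.tensorL f)) (.tensorL (.orR₁ f))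
  | orR₂_tensorL {A' B' : Fma At} {Γ : Cxt At} {A B : Fma At}
      (f : Der (some A') (B' :: Γ) B) :
      Cong (.orR₂ (A := A) (.tensorL f)) (.tensorL (.orR₂ f))
  | orR₁_andL₁ {A' B' : Fma At} {Γ : Cxt At} {A B : Fma At} (f : Der (some A') Γ A) :
      Cong (.orR₁ (B := B) (.andL₁ (B := B') f)) (.andL₁ (.orR₁ f))
  | orR₁_andL₂ {A' B' : Fma At} {Γ : Cxt At} {A B : Fma At} (f : Der (some B') Γ A) :
      Cong (.orR₁ (B := B) (.andL₂ (A := A') f)) (.andL₂ (.orR₁ f))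
  | orR₂_andL₁ {A' B' : Fma At} {Γ : Cxt At} {A B : Fma At} (f : Der (some A') Γ B) :
      Cong (.orR₂ (A := A) (.andL₁ (B := B') f)) (.andL₁ (.orR₂ f))
  | orR₂_andL₂ {A' B' : Fma At} {Γ : Cxt At} {A B : Fma At} (f : Der (some B') Γ B) :
      Cong (.orR₂ (A := A) (.andL₂ (A := A') f)) (.andL₂ (.orR₂ f))
  | orR₁_orL {A' B' : Fma At} {Γ : Cxt At} {A B : Fma At}
      (f : Der (some A') Γ A) (g : Der (some B') Γ A) :
      Cong (.orR₁ (B := B) (.orL f g)) (.orL (.orR₁ f) (.orR₁ g))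
  | orR₂_orL {A' B' : Fma At} {Γ : Cxt At} {A B : Fma At}
      (f : Der (some A') Γ B) (g : Der (some B') Γ B) :
      Cong (.orR₂ (A := A) (.orL f g)) (.orL (.orR₂ f) (.orR₂ g))

/-- Derivations of `S ∣ Γ ⊢ A` as a setoid under `≗`. -/
def congSetoid (S : Stoup At) (Γ : Cxt At) (A : Fma At) : Setoid (Der S Γ A) where
  r := Cong
  iseqv := ⟨Cong.refl, Cong.symm, Cong.trans⟩

/-! ### The focused sequent calculus with tag annotations -/

/-- The four tags. -/
inductive Tag : Type
  | P | C₁ | C₂ | R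
  deriving DecidableEq

/-- Valid lists of tags. -/
def Valid (l : List Tag) : Prop := l ≠ [] ∧ (Tag.R ∈ l ∨ (Tag.C₁ ∈ l ∧ Tag.C₂ ∈ l))

instance (l : List Tag) : Decidable (Valid l) := by unfold Valid; infer_instance

/-- The annotation `t?`: untagged, or tagged with `t`. -/
def Ann (o : Option Tag) (t : Tag) : Prop := o = none ∨ o = some t

/-- Non-negative formulae `P`: the principal connective is not `∧`. -/
def Fma.NonNeg : Fma At → Prop
  | .and _ _ => False
  | _ => True

/-- Irreducible (non-positive) stoups `T`: neither `I`, nor a tensor, nor a disjunction. -/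
def Irr : Stoup At → Prop
  | some .unit => False
  | some (.tensor _ _) => False
  | some (.or _ _) => False
  | _ => True

theorem irr_none : Irr (At := At) none := trivial

theorem irr_atom (X : At) : Irr (some (.atom X)) := trivial

theorem irr_and (A B : Fma At) : Irr (some (.and A B)) := trivial

mutual

/-- Derivations of `S ∣ Γ ⊢ A` in the right invertible phase, untagged (`none`) or tagged with
a list of tags.  Rules `andR` and `li2ri` are given in an untagged and in a tagged version. -/
inductive RI : Option (List Tag) → Stoup At → Cxt At → Fma At → Type u
  | andR {S : Stoup At} {Γ : Cxt At} {A B : Fma At} :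
      RI none S Γ A → RI none S Γ B → RI none S Γ (.and A B)
  | andRT {l l₁ l₂ : List Tag} {S : Stoup At} {Γ : Cxt At} {A B : Fma At}
      (h : l = l₁ ++ l₂) :
      RI (some l₁) S Γ A → RI (some l₂) S Γ B → RI (some l) S Γ (.and A B)
  | li2ri {S : Stoup At} {Γ : Cxt At} {P : Fma At} (hP : P.NonNeg) :
      LI none S Γ P → RI none S Γ P
  | li2riT {t : Tag} {S : Stoup At} {Γ : Cxt At} {P : Fma At} (hP : P.NonNeg) :
      LI (some t) S Γ P → RI (some [t]) S Γ P

/-- Derivations in the left invertible phase, untagged or tagged with a single tag. -/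
inductive LI : Option Tag → Stoup At → Cxt At → Fma At → Type u
  | IL {Γ : Cxt At} {P : Fma At} (hP : P.NonNeg) :
      LI none none Γ P → LI none (some .unit) Γ P
  | tensorL {A B : Fma At} {Γ : Cxt At} {P : Fma At} (hP : P.NonNeg) :
      LI none (some A) (B :: Γ) P → LI none (some (.tensor A B)) Γ P
  | orL {A B : Fma At} {Γ : Cxt At} {P : Fma At} (hP : P.NonNeg) :
      LI none (some A) Γ P → LI none (some B) Γ P → LI none (some (.or A B)) Γ P
  | f2li {o : Option Tag} {T : Stoup At} {Γ : Cxt At} {P : Fma At}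
      (hP : P.NonNeg) (hT : Irr T) : Fo o T Γ P → LI o T Γ P

/-- Derivations in the focusing phase, untagged or tagged with a single tag. -/
inductive Fo : Option Tag → Stoup At → Cxt At → Fma At → Type u
  | pass {o : Option Tag} {A : Fma At} {Γ : Cxt At} {P : Fma At}
      (ho : Ann o .P) (hP : P.NonNeg) : LI none (some A) Γ P → Fo o none (A :: Γ) P
  | ax {o : Option Tag} {X : At} (ho : Ann o .R) : Fo o (some (.atom X)) [] (.atom X)
  | IR {o : Option Tag} (ho : Ann o .R) : Fo o none [] .unit
  | tensorR {o : Option Tag} {l : List Tag} {T : Stoup At} {Γ Δ Θ : Cxt At} {A B : Fma At}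
      (ho : Ann o .R) (hT : Irr T) (h : Θ = Γ ++ Δ) (hl : Valid l) :
      RI (some l) T Γ A → RI none none Δ B → Fo o T Θ (.tensor A B)
  | orR₁ {o : Option Tag} {l : List Tag} {T : Stoup At} {Γ : Cxt At} {A B : Fma At}
      (ho : Ann o .R) (hT : Irr T) (hl : Valid l) : RI (some l) T Γ A → Fo o T Γ (.or A B)
  | orR₂ {o : Option Tag} {l : List Tag} {T : Stoup At} {Γ : Cxt At} {A B : Fma At}
      (ho : Ann o .R) (hT : Irr T) (hl : Valid l) : RI (some l) T Γ B → Fo o T Γ (.or A B)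
  | andL₁ {o : Option Tag} {A B : Fma At} {Γ : Cxt At} {P : Fma At}
      (ho : Ann o .C₁) (hP : P.NonNeg) :
      LI none (some A) Γ P → Fo o (some (.and A B)) Γ P
  | andL₂ {o : Option Tag} {A B : Fma At} {Γ : Cxt At} {P : Fma At}
      (ho : Ann o .C₂) (hP : P.NonNeg) :
      LI none (some B) Γ P → Fo o (some (.and A B)) Γ P

end

/-! ### The embedding: erasing phase and tag annotations -/

mutual

def embRI : {l : Option (List Tag)} → {S : Stoup At} → {Γ : Cxt At} → {A : Fma At} →
    RI l S Γ A → Der S Γ A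
  | _, _, _, _, .andR f g => .andR (embRI f) (embRI g)
  | _, _, _, _, .andRT _ f g => .andR (embRI f) (embRI g)
  | _, _, _, _, .li2ri _ f => embLI f
  | _, _, _, _, .li2riT _ f => embLI f

def embLI : {o : Option Tag} → {S : Stoup At} → {Γ : Cxt At} → {A : Fma At} →
    LI o S Γ A → Der S Γ A
  | _, _, _, _, .IL _ f => .IL (embLI f)
  | _, _, _, _, .tensorL _ f => .tensorL (embLI f)
  | _, _, _, _, .orL _ f g => .orL (embLI f) (embLI g)
  | _, _, _, _, .f2li _ _ f => embFo f

def embFo : {o : Option Tag} → {S : Stoup At} → {Γ : Cxt At} → {A : Fma At} →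
    Fo o S Γ A → Der S Γ A
  | _, _, _, _, .pass _ _ f => .pass (embLI f)
  | _, _, _, _, .ax _ => .ax
  | _, _, _, _, .IR _ => .IR
  | _, _, _, _, .tensorR _ _ h _ f g => .tensorR h (embRI f) (embRI g)
  | _, _, _, _, .orR₁ _ _ _ f => .orR₁ (embRI f)
  | _, _, _, _, .orR₂ _ _ _ f => .orR₂ (embRI f)
  | _, _, _, _, .andL₁ _ _ f => .andL₁ (embLI f)
  | _, _, _, _, .andL₂ _ _ f => .andL₂ (embLI f)

end

/-! ### Lists of derivations -/

/-- `All p [P₁, …, Pₙ]` is the type of lists `[x₁ : p P₁, …, xₙ : p Pₙ]`. -/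
inductive All (p : Fma At → Type u) : List (Fma At) → Type u
  | nil : All p []
  | cons {P : Fma At} {Ps : List (Fma At)} : p P → All p Ps → All p (P :: Ps)

namespace All

variable {p q : Fma At → Type u}

def map (k : ∀ P, p P → q P) : {Ps : List (Fma At)} → All p Ps → All q Ps
  | _, nil => nil
  | _, cons x xs => cons (k _ x) (map k xs)

def append : {Ps Qs : List (Fma At)} → All p Ps → All p Qs → All p (Ps ++ Qs)
  | _, _, nil, ys => ys
  | _, _, cons x xs, ys => cons x (append xs ys)

def fst : (Ps : List (Fma At)) → {Qs : List (Fma At)} → All p (Ps ++ Qs) → All p Ps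
  | [], _, _ => nil
  | _ :: Ps, _, cons x xs => cons x (fst Ps xs)

def snd : (Ps : List (Fma At)) → {Qs : List (Fma At)} → All p (Ps ++ Qs) → All p Qs
  | [], _, xs => xs
  | _ :: Ps, _, cons _ xs => snd Ps xs

end All

/-- The list of formulae obtained by decomposing additive conjunctions in a formula. -/
def Fma.conj : Fma At → List (Fma At)
  | .and A B => A.conj ++ B.conj
  | P => [P]

theorem Fma.conj_ne_nil : (A : Fma At) → A.conj ≠ []
  | .and A _ => fun h => A.conj_ne_nil (List.append_eq_nil_iff.1 h).1
  | .atom _ => List.cons_ne_nil _ _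
  | .unit => List.cons_ne_nil _ _
  | .tensor _ _ => List.cons_ne_nil _ _
  | .or _ _ => List.cons_ne_nil _ _

/-- The one-element list, for a non-negative formula. -/
def All.single {p : Fma At → Type u} : {P : Fma At} → P.NonNeg → p P → All p P.conj
  | .atom _, _, x => .cons x .nil
  | .unit, _, x => .cons x .nil
  | .tensor _ _, _, x => .cons x .nil
  | .or _ _, _, x => .cons x .nil

/-- Invertibility of the right invertible phase. -/
def RI.invert {S : Stoup At} {Γ : Cxt At} :
    {A : Fma At} → RI none S Γ A → All (LI none S Γ) A.conj
  | _, .andR f g => All.append (RI.invert f) (RI.invert g)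
  | _, .li2ri hP f => All.single hP f

/-! ### Tags of untagged derivations in the focusing phase -/

/-- The tag of the last rule of a derivation in the focusing phase. -/
def Fo.tag {o : Option Tag} {S : Stoup At} {Γ : Cxt At} {P : Fma At} : Fo o S Γ P → Tag
  | .pass _ _ _ => .P
  | .andL₁ _ _ _ => .C₁
  | .andL₂ _ _ _ => .C₂
  | .ax _ => .R
  | .IR _ => .R
  | .tensorR _ _ _ _ _ _ => .R
  | .orR₁ _ _ _ _ => .R
  | .orR₂ _ _ _ _ => .R

/-- The tagged version of a derivation in the focusing phase. -/
def Fo.tagged {o : Option Tag} {S : Stoup At} {Γ : Cxt At} {P : Fma At} :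
    (f : Fo o S Γ P) → Fo (some f.tag) S Γ P
  | .pass _ hP f => .pass (.inr rfl) hP f
  | .andL₁ _ hP f => .andL₁ (.inr rfl) hP f
  | .andL₂ _ hP f => .andL₂ (.inr rfl) hP f
  | .ax _ => .ax (.inr rfl)
  | .IR _ => .IR (.inr rfl)
  | .tensorR _ hT h hl f g => .tensorR (.inr rfl) hT h hl f g
  | .orR₁ _ hT hl f => .orR₁ (.inr rfl) hT hl f
  | .orR₂ _ hT hl f => .orR₂ (.inr rfl) hT hl f

/-- The list of tags of a list of derivations. -/
def tags {S : Stoup At} {Γ : Cxt At} :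
    {Ps : List (Fma At)} → All (Fo none S Γ) Ps → List Tag
  | _, .nil => []
  | _, .cons f fs => f.tag :: tags fs

theorem tags_split {S : Stoup At} {Γ : Cxt At} : (Ps : List (Fma At)) → {Qs : List (Fma At)} →
    (fs : All (Fo none S Γ) (Ps ++ Qs)) → tags fs = tags (fs.fst Ps) ++ tags (fs.snd Ps)
  | [], _, _ => rfl
  | _ :: Ps, _, .cons _ fs => congrArg _ (tags_split Ps fs)

/-- The tagged iterated right conjunction rule. -/
def andRStarT {T : Stoup At} {Γ : Cxt At} (hT : Irr T) :
    (A : Fma At) → (fs : All (Fo none T Γ) A.conj) → RI (some (tags fs)) T Γ A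
  | .and A B, fs =>
      .andRT (tags_split A.conj fs) (andRStarT hT A (fs.fst A.conj))
        (andRStarT hT B (fs.snd A.conj))
  | .atom _, .cons f .nil => .li2riT trivial (.f2li trivial hT f.tagged)
  | .unit, .cons f .nil => .li2riT trivial (.f2li trivial hT f.tagged)
  | .tensor _ _, .cons f .nil => .li2riT trivial (.f2li trivial hT f.tagged)
  | .or _ _, .cons f .nil => .li2riT trivial (.f2li trivial hT f.tagged)

/-! ### Inverting the last rule of a derivation -/

def LI.invIL {Γ : Cxt At} {P : Fma At} : LI none (some .unit) Γ P → LI none none Γ P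
  | .IL _ f => f
  | .f2li _ hT _ => False.elim hT

def LI.invTensorL {A B : Fma At} {Γ : Cxt At} {P : Fma At} :
    LI none (some (.tensor A B)) Γ P → LI none (some A) (B :: Γ) P
  | .tensorL _ f => f
  | .f2li _ hT _ => False.elim hT

def LI.invOrL₁ {A B : Fma At} {Γ : Cxt At} {P : Fma At} :
    LI none (some (.or A B)) Γ P → LI none (some A) Γ P
  | .orL _ f _ => f
  | .f2li _ hT _ => False.elim hT

def LI.invOrL₂ {A B : Fma At} {Γ : Cxt At} {P : Fma At} :
    LI none (some (.or A B)) Γ P → LI none (some B) Γ P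
  | .orL _ _ g => g
  | .f2li _ hT _ => False.elim hT

/-- If the stoup is irreducible, a derivation in the left invertible phase ends with a switch
to the focusing phase. -/
def LI.invF : {T : Stoup At} → {Γ : Cxt At} → {P : Fma At} → Irr T →
    LI none T Γ P → Fo none T Γ P
  | _, _, _, _, .f2li _ _ f => f
  | _, _, _, hT, .IL _ _ => False.elim hT
  | _, _, _, hT, .tensorL _ _ => False.elim hT
  | _, _, _, hT, .orL _ _ _ => False.elim hT

def Fo.invPass {A : Fma At} {Γ : Cxt At} {P : Fma At} :
    (f : Fo none none (A :: Γ) P) → f.tag = .P → LI none (some A) Γ P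
  | .pass _ _ f, _ => f
  | .tensorR _ _ _ _ _ _, h => Tag.noConfusion h
  | .orR₁ _ _ _ _, h => Tag.noConfusion h
  | .orR₂ _ _ _ _, h => Tag.noConfusion h

def Fo.invAndL₁ {A B : Fma At} {Γ : Cxt At} {P : Fma At} :
    (f : Fo none (some (.and A B)) Γ P) → f.tag = .C₁ → LI none (some A) Γ P
  | .andL₁ _ _ f, _ => f
  | .andL₂ _ _ _, h => Tag.noConfusion h
  | .tensorR _ _ _ _ _ _, h => Tag.noConfusion h
  | .orR₁ _ _ _ _, h => Tag.noConfusion h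
  | .orR₂ _ _ _ _, h => Tag.noConfusion h

def Fo.invAndL₂ {A B : Fma At} {Γ : Cxt At} {P : Fma At} :
    (f : Fo none (some (.and A B)) Γ P) → f.tag = .C₂ → LI none (some B) Γ P
  | .andL₂ _ _ f, _ => f
  | .andL₁ _ _ _, h => Tag.noConfusion h
  | .tensorR _ _ _ _ _ _, h => Tag.noConfusion h
  | .orR₁ _ _ _ _, h => Tag.noConfusion h
  | .orR₂ _ _ _ _, h => Tag.noConfusion h

/-- Inverting the last rule of each derivation in a list whose tags are all equal to `t`. -/
def invAll {S S' : Stoup At} {Γ Γ' : Cxt At} {t : Tag}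
    (k : ∀ P, (f : Fo none S Γ P) → f.tag = t → LI none S' Γ' P) :
    {Ps : List (Fma At)} → (fs : All (Fo none S Γ) Ps) → (∀ s ∈ tags fs, s = t) →
      All (LI none S' Γ') Ps
  | _, .nil, _ => .nil
  | _, .cons f fs, h =>
      .cons (k _ f (h _ List.mem_cons_self))
        (invAll k fs fun s hs => h s (List.mem_cons_of_mem _ hs))

theorem Fo.tag_none : {Γ : Cxt At} → {P : Fma At} → (f : Fo none none Γ P) →
    f.tag = .P ∨ f.tag = .R
  | _, _, .pass _ _ _ => .inl rfl
  | _, _, .IR _ => .inr rfl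
  | _, _, .tensorR _ _ _ _ _ _ => .inr rfl
  | _, _, .orR₁ _ _ _ _ => .inr rfl
  | _, _, .orR₂ _ _ _ _ => .inr rfl

theorem Fo.tag_and {A B : Fma At} : {Γ : Cxt At} → {P : Fma At} →
    (f : Fo none (some (.and A B)) Γ P) → f.tag = .C₁ ∨ f.tag = .C₂ ∨ f.tag = .R
  | _, _, .andL₁ _ _ _ => .inl rfl
  | _, _, .andL₂ _ _ _ => .inr (.inl rfl)
  | _, _, .tensorR _ _ _ _ _ _ => .inr (.inr rfl)
  | _, _, .orR₁ _ _ _ _ => .inr (.inr rfl)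
  | _, _, .orR₂ _ _ _ _ => .inr (.inr rfl)

theorem tags_none {Γ : Cxt At} : {Ps : List (Fma At)} → (fs : All (Fo none none Γ) Ps) →
    ∀ s ∈ tags fs, s = .P ∨ s = .R
  | _, .cons f fs, s, hs => by
      rcases List.mem_cons.1 hs with rfl | hs
      · exact f.tag_none
      · exact tags_none fs s hs

theorem tags_and {A B : Fma At} {Γ : Cxt At} : {Ps : List (Fma At)} →
    (fs : All (Fo none (some (.and A B)) Γ) Ps) → ∀ s ∈ tags fs, s = .C₁ ∨ s = .C₂ ∨ s = .R
  | _, .cons f fs, s, hs => by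
      rcases List.mem_cons.1 hs with rfl | hs
      · exact f.tag_and
      · exact tags_and fs s hs

theorem tags_pass {Γ : Cxt At} {Ps : List (Fma At)} (fs : All (Fo none none Γ) Ps)
    (h : ¬ Valid (.P :: tags fs)) : ∀ s ∈ tags fs, s = .P := by
  intro s hs
  rcases tags_none fs s hs with rfl | rfl
  · rfl
  · exact absurd ⟨List.cons_ne_nil _ _, .inl (List.mem_cons_of_mem _ hs)⟩ h

theorem tags_andL₁ {A B : Fma At} {Γ : Cxt At} {Ps : List (Fma At)}
    (fs : All (Fo none (some (.and A B)) Γ) Ps) (h : ¬ Valid (.C₁ :: tags fs)) :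
    ∀ s ∈ tags fs, s = .C₁ := by
  intro s hs
  rcases tags_and fs s hs with rfl | rfl | rfl
  · rfl
  · exact absurd ⟨List.cons_ne_nil _ _,
      .inr ⟨List.mem_cons_self, List.mem_cons_of_mem _ hs⟩⟩ h
  · exact absurd ⟨List.cons_ne_nil _ _, .inl (List.mem_cons_of_mem _ hs)⟩ h

theorem tags_andL₂ {A B : Fma At} {Γ : Cxt At} {Ps : List (Fma At)}
    (fs : All (Fo none (some (.and A B)) Γ) Ps) (h : ¬ Valid (.C₂ :: tags fs)) :
    ∀ s ∈ tags fs, s = .C₂ := by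
  intro s hs
  rcases tags_and fs s hs with rfl | rfl | rfl
  · exact absurd ⟨List.cons_ne_nil _ _,
      .inr ⟨List.mem_cons_of_mem _ hs, List.mem_cons_self⟩⟩ h
  · rfl
  · exact absurd ⟨List.cons_ne_nil _ _, .inl (List.mem_cons_of_mem _ hs)⟩ h

theorem valid_R (l : List Tag) : Valid (.R :: l) :=
  ⟨List.cons_ne_nil _ _, .inl List.mem_cons_self⟩

/-! ### The generalized right non-invertible rules -/

/-- The three right non-invertible rules, waiting for their (first) premise, whose succedent
is the first index.  The second index is the succedent of the conclusion, and the third is the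
list of formulae that the rule appends to the context of that premise. -/
inductive RightRule : Fma At → Fma At → Cxt At → Type u
  | tensorR {A B : Fma At} {Δ : Cxt At} (g : RI none none Δ B) :
      RightRule A (.tensor A B) Δ
  | orR₁ {A B : Fma At} : RightRule A (.or A B) []
  | orR₂ {A B : Fma At} : RightRule B (.or A B) []

theorem RightRule.nonNeg {A C : Fma At} {Δ : Cxt At} : RightRule A C Δ → C.NonNeg
  | .tensorR _ => trivial
  | .orR₁ => trivial
  | .orR₂ => trivial

/-- Applying a right non-invertible rule in the focusing phase. -/
def RightRule.fire {T : Stoup At} {Γ Θ : Cxt At} {l : List Tag} (hT : Irr T) (hl : Valid l) :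
    {A C : Fma At} → {Δ : Cxt At} → RightRule A C Δ → Θ = Γ ++ Δ →
      RI (some l) T Γ A → Fo none T Θ C
  | _, _, _, .tensorR g, h, f => .tensorR (.inl rfl) hT h hl f g
  | _, _, _, .orR₁, h, f =>
      match Θ, h.trans (List.append_nil Γ) with
      | _, rfl => .orR₁ (.inl rfl) hT hl f
  | _, _, _, .orR₂, h, f =>
      match Θ, h.trans (List.append_nil Γ) with
      | _, rfl => .orR₂ (.inl rfl) hT hl f

/-- Firing on a list of derivations in the focusing phase whose list of tags is valid. -/
def RightRule.fireAll {T : Stoup At} {Γ Θ : Cxt At} {A C : Fma At} {Δ : Cxt At}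
    {Qs : List (Fma At)} (r : RightRule A C Δ) (hA : A.conj = Qs) (hΘ : Θ = Γ ++ Δ)
    (hT : Irr T) (fs : All (Fo none T Γ) Qs) (hl : Valid (tags fs)) : Fo none T Θ C :=
  match Qs, hA, fs, hl with
  | _, rfl, fs, hl => r.fire hT hl hΘ (andRStarT hT A fs)

mutual

/-- The generalized right rule in the left invertible phase, by recursion on the first
derivation of the list. -/
def genLI {A C : Fma At} {Δ : Cxt At} {P : Fma At} {Ps : List (Fma At)}
    (r : RightRule A C Δ) (hA : A.conj = P :: Ps) : {S : Stoup At} → {Γ Θ : Cxt At} →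
    Θ = Γ ++ Δ → LI none S Γ P → All (LI none S Γ) Ps → LI none S Θ C
  | _, _, _, hΘ, .IL _ f, fs =>
      .IL r.nonNeg (genLI r hA hΘ f (fs.map fun _ => LI.invIL))
  | _, _, _, hΘ, .tensorL _ f, fs =>
      .tensorL r.nonNeg
        (genLI r hA (congrArg (List.cons _) hΘ) f (fs.map fun _ => LI.invTensorL))
  | _, _, _, hΘ, .orL _ f g, fs =>
      .orL r.nonNeg (genLI r hA hΘ f (fs.map fun _ => LI.invOrL₁))
        (genLI r hA hΘ g (fs.map fun _ => LI.invOrL₂))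
  | _, _, _, hΘ, .f2li _ hT f, fs =>
      .f2li r.nonNeg hT (genFo r hA hT hΘ f (fs.map fun _ => LI.invF hT))

/-- The generalized right rule in the focusing phase: it is fired if the list of tags is valid;
otherwise all derivations end with the same left non-invertible rule, which is permuted down. -/
def genFo {A C : Fma At} {Δ : Cxt At} {P : Fma At} {Ps : List (Fma At)}
    (r : RightRule A C Δ) (hA : A.conj = P :: Ps) : {T : Stoup At} → {Γ Θ : Cxt At} →
    Irr T → Θ = Γ ++ Δ → Fo none T Γ P → All (Fo none T Γ) Ps → Fo none T Θ C
  | _, _, Θ, hT, hΘ, .pass ho hP f, fs =>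
      if hl : Valid (.P :: tags fs) then r.fireAll hA hΘ hT (.cons (.pass ho hP f) fs) hl
      else match Θ, hΘ with
        | _, rfl => .pass (.inl rfl) r.nonNeg
            (genLI r hA rfl f (invAll (fun _ => Fo.invPass) fs (tags_pass fs hl)))
  | _, _, _, hT, hΘ, .andL₁ ho hP f, fs =>
      if hl : Valid (.C₁ :: tags fs) then r.fireAll hA hΘ hT (.cons (.andL₁ ho hP f) fs) hl
      else .andL₁ (.inl rfl) r.nonNeg
        (genLI r hA hΘ f (invAll (fun _ => Fo.invAndL₁) fs (tags_andL₁ fs hl)))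
  | _, _, _, hT, hΘ, .andL₂ ho hP f, fs =>
      if hl : Valid (.C₂ :: tags fs) then r.fireAll hA hΘ hT (.cons (.andL₂ ho hP f) fs) hl
      else .andL₂ (.inl rfl) r.nonNeg
        (genLI r hA hΘ f (invAll (fun _ => Fo.invAndL₂) fs (tags_andL₂ fs hl)))
  | _, _, _, hT, hΘ, .ax ho, fs => r.fireAll hA hΘ hT (.cons (.ax ho) fs) (valid_R _)
  | _, _, _, hT, hΘ, .IR ho, fs => r.fireAll hA hΘ hT (.cons (.IR ho) fs) (valid_R _)
  | _, _, _, hT, hΘ, .tensorR ho hT' h hl f g, fs =>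
      r.fireAll hA hΘ hT (.cons (.tensorR ho hT' h hl f g) fs) (valid_R _)
  | _, _, _, hT, hΘ, .orR₁ ho hT' hl f, fs =>
      r.fireAll hA hΘ hT (.cons (.orR₁ ho hT' hl f) fs) (valid_R _)
  | _, _, _, hT, hΘ, .orR₂ ho hT' hl f, fs =>
      r.fireAll hA hΘ hT (.cons (.orR₂ ho hT' hl f) fs) (valid_R _)

end

/-- The generalized right rule on a list of derivations. -/
def genAll {A C : Fma At} {Δ : Cxt At} (r : RightRule A C Δ) {S : Stoup At} {Γ Θ : Cxt At}
    (hΘ : Θ = Γ ++ Δ) : {Qs : List (Fma At)} → A.conj = Qs → All (LI none S Γ) Qs →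
    LI none S Θ C
  | _, hA, .nil => absurd hA A.conj_ne_nil
  | _, hA, .cons f fs => genLI r hA hΘ f fs

/-- The right non-invertible rules are admissible in the right invertible phase. -/
def RightRule.applyRI {A C : Fma At} {Δ : Cxt At} (r : RightRule A C Δ) {S : Stoup At}
    {Γ Θ : Cxt At} (hΘ : Θ = Γ ++ Δ) (f : RI none S Γ A) : RI none S Θ C :=
  .li2ri r.nonNeg (genAll r hΘ rfl f.invert)

/-! ### The admissible rules in the right invertible phase -/

namespace RI

def tensorRRI {S : Stoup At} {Γ Δ Θ : Cxt At} {A B : Fma At} (h : Θ = Γ ++ Δ)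
    (f : RI none S Γ A) (g : RI none none Δ B) : RI none S Θ (.tensor A B) :=
  (RightRule.tensorR g).applyRI h f

def orR₁RI {S : Stoup At} {Γ : Cxt At} {A B : Fma At} (f : RI none S Γ A) :
    RI none S Γ (.or A B) :=
  RightRule.orR₁.applyRI (List.append_nil Γ).symm f

def orR₂RI {S : Stoup At} {Γ : Cxt At} {A B : Fma At} (f : RI none S Γ B) :
    RI none S Γ (.or A B) :=
  RightRule.orR₂.applyRI (List.append_nil Γ).symm f

def passRI {A : Fma At} {Γ : Cxt At} :
    {C : Fma At} → RI none (some A) Γ C → RI none none (A :: Γ) C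
  | _, .andR f g => .andR (passRI f) (passRI g)
  | _, .li2ri hP f => .li2ri hP (.f2li hP irr_none (.pass (.inl rfl) hP f))

def ILRI {Γ : Cxt At} : {C : Fma At} → RI none none Γ C → RI none (some .unit) Γ C
  | _, .andR f g => .andR (ILRI f) (ILRI g)
  | _, .li2ri hP f => .li2ri hP (.IL hP f)

def IRRI : RI (At := At) none none [] .unit :=
  .li2ri trivial (.f2li trivial irr_none (.IR (.inl rfl)))

def tensorLRI {A B : Fma At} {Γ : Cxt At} :
    {C : Fma At} → RI none (some A) (B :: Γ) C → RI none (some (.tensor A B)) Γ C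
  | _, .andR f g => .andR (tensorLRI f) (tensorLRI g)
  | _, .li2ri hP f => .li2ri hP (.tensorL hP f)

def andL₁RI {A B : Fma At} {Γ : Cxt At} :
    {C : Fma At} → RI none (some A) Γ C → RI none (some (.and A B)) Γ C
  | _, .andR f g => .andR (andL₁RI f) (andL₁RI g)
  | _, .li2ri hP f => .li2ri hP (.f2li hP (irr_and _ _) (.andL₁ (.inl rfl) hP f))

def andL₂RI {A B : Fma At} {Γ : Cxt At} :
    {C : Fma At} → RI none (some B) Γ C → RI none (some (.and A B)) Γ C
  | _, .andR f g => .andR (andL₂RI f) (andL₂RI g)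
  | _, .li2ri hP f => .li2ri hP (.f2li hP (irr_and _ _) (.andL₂ (.inl rfl) hP f))

def orLRI {A B : Fma At} {Γ : Cxt At} :
    {C : Fma At} → RI none (some A) Γ C → RI none (some B) Γ C → RI none (some (.or A B)) Γ C
  | _, .andR f f', .andR g g' => .andR (orLRI f g) (orLRI f' g')
  | _, .li2ri hP f, .li2ri _ g => .li2ri hP (.orL hP f g)
  | _, .andR _ _, .li2ri hP _ => False.elim hP
  | _, .li2ri hP _, .andR _ _ => False.elim hP

def axRI : (A : Fma At) → RI none (some A) [] A
  | .atom _ => .li2ri trivial (.f2li trivial (irr_atom _) (.ax (.inl rfl)))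
  | .unit => ILRI IRRI
  | .tensor A B => tensorLRI (tensorRRI (Γ := []) rfl (axRI A) (passRI (axRI B)))
  | .and A B => .andR (andL₁RI (axRI A)) (andL₂RI (axRI B))
  | .or A B => orLRI (orR₁RI (axRI A)) (orR₂RI (axRI B))

end RI

/-- The focusing function: each inference rule is sent to the corresponding admissible rule in
the right invertible phase. -/
def focus : {S : Stoup At} → {Γ : Cxt At} → {A : Fma At} → Der S Γ A → RI none S Γ A
  | _, _, _, .ax => RI.axRI _
  | _, _, _, .pass f => RI.passRI (focus f)
  | _, _, _, .IL f => RI.ILRI (focus f)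
  | _, _, _, .IR => RI.IRRI
  | _, _, _, .tensorL f => RI.tensorLRI (focus f)
  | _, _, _, .tensorR h f g => RI.tensorRRI h (focus f) (focus g)
  | _, _, _, .andL₁ f => RI.andL₁RI (focus f)
  | _, _, _, .andL₂ f => RI.andL₂RI (focus f)
  | _, _, _, .andR f g => .andR (focus f) (focus g)
  | _, _, _, .orL f g => RI.orLRI (focus f) (focus g)
  | _, _, _, .orR₁ f => RI.orR₁RI (focus f)
  | _, _, _, .orR₂ f => RI.orR₂RI (focus f)

end SkewAdd

open SkewAdd

namespace SkewAdd

variable {At : Type u}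

/-! ### Lists of derivations -/

namespace All

variable {p q r : Fma At → Type u}

theorem map_map (k : ∀ P, p P → q P) (k' : ∀ P, q P → r P) :
    {Ps : List (Fma At)} → (xs : All p Ps) →
      (xs.map k).map k' = xs.map fun P x => k' P (k P x)
  | _, .nil => rfl
  | _, .cons _ xs => congrArg _ (map_map k k' xs)

theorem map_congr {k k' : ∀ P, p P → q P} (h : ∀ P x, k P x = k' P x) :
    {Ps : List (Fma At)} → (xs : All p Ps) → xs.map k = xs.map k'
  | _, .nil => rfl
  | _, .cons x xs => by simp only [map, h _ x, map_congr h xs]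

theorem map_id {k : ∀ P, p P → p P} (h : ∀ P x, k P x = x) :
    {Ps : List (Fma At)} → (xs : All p Ps) → xs.map k = xs
  | _, .nil => rfl
  | _, .cons x xs => by simp only [map, h _ x, map_id h xs]

theorem map_append (k : ∀ P, p P → q P) :
    {Ps Qs : List (Fma At)} → (xs : All p Ps) → (ys : All p Qs) →
      (xs.append ys).map k = (xs.map k).append (ys.map k)
  | _, _, .nil, _ => rfl
  | _, _, .cons _ xs, ys => congrArg _ (map_append k xs ys)

theorem map_append_conj (k : ∀ P, p P → q P) {A B : Fma At} (xs : All p A.conj)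
    (ys : All p B.conj) :
    map k (Ps := (A.and B).conj) (xs.append ys) = (xs.map k).append (ys.map k) :=
  map_append k xs ys

theorem map_fst (k : ∀ P, p P → q P) : (Ps : List (Fma At)) → {Qs : List (Fma At)} →
    (xs : All p (Ps ++ Qs)) → (xs.map k).fst Ps = (xs.fst Ps).map k
  | [], _, _ => rfl
  | _ :: Ps, _, .cons _ xs => congrArg _ (map_fst k Ps xs)

theorem map_snd (k : ∀ P, p P → q P) : (Ps : List (Fma At)) → {Qs : List (Fma At)} →
    (xs : All p (Ps ++ Qs)) → (xs.map k).snd Ps = (xs.snd Ps).map k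
  | [], _, _ => rfl
  | _ :: Ps, _, .cons _ xs => map_snd k Ps xs

theorem fst_append : {Ps Qs : List (Fma At)} → (xs : All p Ps) → (ys : All p Qs) →
    (xs.append ys).fst Ps = xs
  | _, _, .nil, _ => rfl
  | _, _, .cons _ xs, ys => congrArg _ (fst_append xs ys)

theorem snd_append : {Ps Qs : List (Fma At)} → (xs : All p Ps) → (ys : All p Qs) →
    (xs.append ys).snd Ps = ys
  | _, _, .nil, _ => rfl
  | _, _, .cons _ xs, ys => snd_append xs ys

theorem map_single (k : ∀ P, p P → q P) : {P : Fma At} → (hP : P.NonNeg) → (x : p P) →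
    (single hP x).map k = single hP (k P x)
  | .atom _, _, _ => rfl
  | .unit, _, _ => rfl
  | .tensor _ _, _, _ => rfl
  | .or _ _, _, _ => rfl

end All

theorem Fo.nonNeg {o : Option Tag} {S : Stoup At} {Γ : Cxt At} {P : Fma At} :
    Fo o S Γ P → P.NonNeg
  | .pass _ hP _ => hP
  | .andL₁ _ hP _ => hP
  | .andL₂ _ hP _ => hP
  | .ax _ => trivial
  | .IR _ => trivial
  | .tensorR _ _ _ _ _ _ => trivial
  | .orR₁ _ _ _ _ => trivial
  | .orR₂ _ _ _ _ => trivial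

theorem LI.nonNeg {o : Option Tag} {S : Stoup At} {Γ : Cxt At} {P : Fma At} :
    LI o S Γ P → P.NonNeg
  | .IL hP _ => hP
  | .tensorL hP _ => hP
  | .orL hP _ _ => hP
  | .f2li hP _ _ => hP

theorem ann_none (t : Tag) : Ann none t := .inl rfl

/-! ### Left rules in the left invertible phase -/

def LI.passLI {A : Fma At} {Γ : Cxt At} {P : Fma At} (f : LI none (some A) Γ P) :
    LI none none (A :: Γ) P :=
  .f2li f.nonNeg irr_none (.pass (ann_none _) f.nonNeg f)

def LI.andL₁LI {A B : Fma At} {Γ : Cxt At} {P : Fma At} (f : LI none (some A) Γ P) :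
    LI none (some (.and A B)) Γ P :=
  .f2li f.nonNeg (irr_and _ _) (.andL₁ (ann_none _) f.nonNeg f)

def LI.andL₂LI {A B : Fma At} {Γ : Cxt At} {P : Fma At} (f : LI none (some B) Γ P) :
    LI none (some (.and A B)) Γ P :=
  .f2li f.nonNeg (irr_and _ _) (.andL₂ (ann_none _) f.nonNeg f)

theorem RI.invert_passRI {A : Fma At} {Γ : Cxt At} : {C : Fma At} →
    (f : RI none (some A) Γ C) → (passRI f).invert = f.invert.map fun _ => LI.passLI
  | _, .andR f g => by
      simp only [passRI, invert, All.map_append_conj, invert_passRI f, invert_passRI g]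
      rfl
  | _, .li2ri hP f => by
      simp only [passRI, invert, All.map_single]
      rfl

theorem RI.invert_andL₁RI {A B : Fma At} {Γ : Cxt At} : {C : Fma At} →
    (f : RI none (some A) Γ C) →
      (andL₁RI (B := B) f).invert = f.invert.map fun _ => LI.andL₁LI
  | _, .andR f g => by
      simp only [andL₁RI, invert, All.map_append_conj, invert_andL₁RI f, invert_andL₁RI g]
      rfl
  | _, .li2ri hP f => by
      simp only [andL₁RI, invert, All.map_single]
      rfl

theorem RI.invert_andL₂RI {A B : Fma At} {Γ : Cxt At} : {C : Fma At} →
    (f : RI none (some B) Γ C) →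
      (andL₂RI (A := A) f).invert = f.invert.map fun _ => LI.andL₂LI
  | _, .andR f g => by
      simp only [andL₂RI, invert, All.map_append_conj, invert_andL₂RI f, invert_andL₂RI g]
      rfl
  | _, .li2ri hP f => by
      simp only [andL₂RI, invert, All.map_single]
      rfl

theorem RI.invert_ILRI {Γ : Cxt At} : {C : Fma At} → (f : RI none none Γ C) →
    (ILRI f).invert.map (fun _ => LI.invIL) = f.invert
  | _, .andR f g => by
      simp only [ILRI, invert, All.map_append_conj, invert_ILRI f, invert_ILRI g]
      rfl
  | _, .li2ri hP _ => by
      simp only [ILRI, invert, All.map_single]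
      rfl

theorem RI.invert_tensorLRI {A B : Fma At} {Γ : Cxt At} : {C : Fma At} →
    (f : RI none (some A) (B :: Γ) C) →
      (tensorLRI f).invert.map (fun _ => LI.invTensorL) = f.invert
  | _, .andR f g => by
      simp only [tensorLRI, invert, All.map_append_conj, invert_tensorLRI f, invert_tensorLRI g]
      rfl
  | _, .li2ri hP _ => by
      simp only [tensorLRI, invert, All.map_single]
      rfl

theorem RI.invert_orLRI₁ {A B : Fma At} {Γ : Cxt At} : {C : Fma At} →
    (f : RI none (some A) Γ C) → (g : RI none (some B) Γ C) →
      (orLRI f g).invert.map (fun _ => LI.invOrL₁) = f.invert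
  | _, .andR f f', .andR g g' => by
      simp only [orLRI, invert, All.map_append_conj, invert_orLRI₁ f g, invert_orLRI₁ f' g']
      rfl
  | _, .li2ri hP _, .li2ri _ _ => by
      simp only [orLRI, invert, All.map_single]
      rfl
  | _, .andR _ _, .li2ri hP _ => False.elim hP
  | _, .li2ri hP _, .andR _ _ => False.elim hP

theorem RI.invert_orLRI₂ {A B : Fma At} {Γ : Cxt At} : {C : Fma At} →
    (f : RI none (some A) Γ C) → (g : RI none (some B) Γ C) →
      (orLRI f g).invert.map (fun _ => LI.invOrL₂) = g.invert
  | _, .andR f f', .andR g g' => by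
      simp only [orLRI, invert, All.map_append_conj, invert_orLRI₂ f g, invert_orLRI₂ f' g']
      rfl
  | _, .li2ri hP _, .li2ri _ _ => by
      simp only [orLRI, invert, All.map_single]
      rfl
  | _, .andR _ _, .li2ri hP _ => False.elim hP
  | _, .li2ri hP _, .andR _ _ => False.elim hP

theorem genFo_of_valid {A C : Fma At} {Δ : Cxt At} {P : Fma At} {Ps : List (Fma At)}
    (r : RightRule A C Δ) (hA : A.conj = P :: Ps) {T : Stoup At} {Γ Θ : Cxt At}
    (hT : Irr T) (hΘ : Θ = Γ ++ Δ) (f : Fo none T Γ P) (fs : All (Fo none T Γ) Ps)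
    (hl : Valid (tags (.cons f fs))) :
    genFo r hA hT hΘ f fs = r.fireAll hA hΘ hT (.cons f fs) hl := by
  cases f with
  | pass _ _ _ =>
      subst hΘ
      rw [genFo]
      exact dif_pos hl
  | andL₁ _ _ _ | andL₂ _ _ _ =>
      rw [genFo]
      exact dif_pos hl
  | ax _ | IR _ | tensorR _ _ _ _ _ _ | orR₁ _ _ _ _ | orR₂ _ _ _ _ => rw [genFo]

/-! ### The generalized right rules commute with the left rules -/

section

variable {A C : Fma At} {Δ : Cxt At} (r : RightRule A C Δ)

theorem genAll_IL {Γ Θ : Cxt At} (hΘ : Θ = Γ ++ Δ) :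
    {Qs : List (Fma At)} → (hA : A.conj = Qs) → (fs : All (LI none (some .unit) Γ) Qs) →
      genAll r hΘ hA fs = .IL r.nonNeg (genAll r hΘ hA (fs.map fun _ => LI.invIL))
  | _, hA, .nil => absurd hA A.conj_ne_nil
  | _, _, .cons (.IL _ _) _ => by simp only [genAll, genLI, All.map, LI.invIL]
  | _, _, .cons (.f2li _ hT _) _ => False.elim hT

theorem genAll_tensorL {A' B' : Fma At} {Γ Θ : Cxt At} (hΘ : Θ = Γ ++ Δ)
    (hΘ' : B' :: Θ = B' :: Γ ++ Δ) :
    {Qs : List (Fma At)} → (hA : A.conj = Qs) →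
      (fs : All (LI none (some (.tensor A' B')) Γ) Qs) →
      genAll r hΘ hA fs =
        .tensorL r.nonNeg (genAll r hΘ' hA (fs.map fun _ => LI.invTensorL))
  | _, hA, .nil => absurd hA A.conj_ne_nil
  | _, _, .cons (.tensorL _ _) _ => by simp only [genAll, genLI, All.map, LI.invTensorL]
  | _, _, .cons (.f2li _ hT _) _ => False.elim hT

theorem genAll_orL {A' B' : Fma At} {Γ Θ : Cxt At} (hΘ : Θ = Γ ++ Δ) :
    {Qs : List (Fma At)} → (hA : A.conj = Qs) →
      (fs : All (LI none (some (.or A' B')) Γ) Qs) →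
      genAll r hΘ hA fs =
        .orL r.nonNeg (genAll r hΘ hA (fs.map fun _ => LI.invOrL₁))
          (genAll r hΘ hA (fs.map fun _ => LI.invOrL₂))
  | _, hA, .nil => absurd hA A.conj_ne_nil
  | _, _, .cons (.orL _ _ _) _ => by
      simp only [genAll, genLI, All.map, LI.invOrL₁, LI.invOrL₂]
  | _, _, .cons (.f2li _ hT _) _ => False.elim hT

theorem tags_map_const {S S' : Stoup At} {Γ Γ' : Cxt At} {t : Tag}
    {k : ∀ P, LI none S Γ P → Fo none S' Γ' P} (hk : ∀ P f, (k P f).tag = t) :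
    {Ps : List (Fma At)} → (fs : All (LI none S Γ) Ps) → ∀ s ∈ tags (fs.map k), s = t
  | _, .cons f fs, s, hs => by
      rcases List.mem_cons.1 hs with rfl | hs
      · exact hk _ f
      · exact tags_map_const hk fs s hs

theorem not_valid_of_forall {t : Tag} (ht : t ≠ .R) {l : List Tag} (h : ∀ s ∈ l, s = t) :
    ¬ Valid (t :: l) := by
  have h' : ∀ s ∈ t :: l, s = t := fun s hs => (List.mem_cons.1 hs).elim id (h s)
  rintro ⟨-, hR | ⟨h₁, h₂⟩⟩
  · exact ht (h' _ hR).symm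
  · exact absurd ((h' _ h₁).trans (h' _ h₂).symm) (by decide)

theorem invAll_map {S S' : Stoup At} {Γ Γ' : Cxt At} {t : Tag}
    (k : ∀ P, (f : Fo none S Γ P) → f.tag = t → LI none S' Γ' P)
    {k' : ∀ P, LI none S' Γ' P → Fo none S Γ P} (hk : ∀ P f h, k P (k' P f) h = f) :
    {Ps : List (Fma At)} → (fs : All (LI none S' Γ') Ps) → (h : ∀ s ∈ tags (fs.map k'), s = t) →
      invAll k (fs.map k') h = fs
  | _, .nil, _ => rfl
  | _, .cons f fs, _ => by simp only [All.map, invAll, hk, invAll_map k hk fs]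

theorem genFo_pass {P A' : Fma At} {Ps : List (Fma At)} (hA : A.conj = P :: Ps) {Γ Θ : Cxt At}
    (hΘ : Θ = Γ ++ Δ) (hΘ' : A' :: Θ = A' :: Γ ++ Δ) (hT : Irr none) (ho : Ann none .P)
    (hP : P.NonNeg) (f : LI none (some A') Γ P) (fs : All (Fo none none (A' :: Γ)) Ps)
    (h : ∀ s ∈ tags fs, s = .P) :
    genFo r hA hT hΘ' (.pass ho hP f) fs =
      .pass (ann_none _) r.nonNeg (genLI r hA hΘ f (invAll (fun _ => Fo.invPass) fs h)) := by
  subst hΘ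
  rw [genFo.eq_def]
  exact dif_neg (not_valid_of_forall (by decide) h)

theorem genFo_andL₁ {P A' B' : Fma At} {Ps : List (Fma At)} (hA : A.conj = P :: Ps)
    {Γ Θ : Cxt At} (hΘ : Θ = Γ ++ Δ) (hT : Irr (some (.and A' B'))) (ho : Ann none .C₁)
    (hP : P.NonNeg) (f : LI none (some A') Γ P) (fs : All (Fo none (some (.and A' B')) Γ) Ps)
    (h : ∀ s ∈ tags fs, s = .C₁) :
    genFo r hA hT hΘ (.andL₁ ho hP f) fs =
      .andL₁ (ann_none _) r.nonNeg (genLI r hA hΘ f (invAll (fun _ => Fo.invAndL₁) fs h)) := by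
  rw [genFo.eq_def]
  exact dif_neg (not_valid_of_forall (by decide) h)

theorem genFo_andL₂ {P A' B' : Fma At} {Ps : List (Fma At)} (hA : A.conj = P :: Ps)
    {Γ Θ : Cxt At} (hΘ : Θ = Γ ++ Δ) (hT : Irr (some (.and A' B'))) (ho : Ann none .C₂)
    (hP : P.NonNeg) (f : LI none (some B') Γ P) (fs : All (Fo none (some (.and A' B')) Γ) Ps)
    (h : ∀ s ∈ tags fs, s = .C₂) :
    genFo r hA hT hΘ (.andL₂ ho hP f) fs =
      .andL₂ (ann_none _) r.nonNeg (genLI r hA hΘ f (invAll (fun _ => Fo.invAndL₂) fs h)) := by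
  rw [genFo.eq_def]
  exact dif_neg (not_valid_of_forall (by decide) h)

theorem genAll_pass {A' : Fma At} {Γ Θ : Cxt At} (hΘ : Θ = Γ ++ Δ)
    (hΘ' : A' :: Θ = A' :: Γ ++ Δ) :
    {Qs : List (Fma At)} → (hA : A.conj = Qs) → (fs : All (LI none (some A') Γ) Qs) →
      genAll r hΘ' hA (fs.map fun _ => LI.passLI) = (genAll r hΘ hA fs).passLI
  | _, hA, .nil => absurd hA A.conj_ne_nil
  | _, hA, .cons f fs => by
      have e : ((fs.map fun _ => LI.passLI).map fun _ => LI.invF irr_none) =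
          fs.map fun _ f => .pass (ann_none _) f.nonNeg f := All.map_map _ _ fs
      have hv := tags_map_const (t := .P)
        (k := fun P (f : LI none (some A') Γ P) => .pass (ann_none _) f.nonNeg f)
        (fun _ _ => rfl) fs
      simp only [genAll, All.map, LI.passLI, genLI]
      rw [e, genFo_pass r hA hΘ hΘ' _ _ _ _ _ hv]
      exact congrArg (fun gs => (genLI r hA hΘ f gs).passLI)
        (invAll_map (fun _ => Fo.invPass) (fun _ _ _ => rfl) fs _)

theorem genAll_andL₁ {A' B' : Fma At} {Γ Θ : Cxt At} (hΘ : Θ = Γ ++ Δ) :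
    {Qs : List (Fma At)} → (hA : A.conj = Qs) → (fs : All (LI none (some A') Γ) Qs) →
      genAll r hΘ hA (fs.map fun _ => LI.andL₁LI) =
        (genAll r hΘ hA fs).andL₁LI (B := B')
  | _, hA, .nil => absurd hA A.conj_ne_nil
  | _, hA, .cons f fs => by
      have e : ((fs.map fun _ => LI.andL₁LI).map fun _ => LI.invF (irr_and A' B')) =
          fs.map fun _ f => .andL₁ (ann_none _) f.nonNeg f := All.map_map _ _ fs
      have hv := tags_map_const (t := .C₁)
        (k := fun P (f : LI none (some A') Γ P) => .andL₁ (B := B') (ann_none _) f.nonNeg f)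
        (fun _ _ => rfl) fs
      simp only [genAll, All.map, LI.andL₁LI, genLI]
      rw [e, genFo_andL₁ r hA hΘ _ _ _ _ _ hv]
      exact congrArg (fun gs => (genLI r hA hΘ f gs).andL₁LI)
        (invAll_map (fun _ => Fo.invAndL₁) (fun _ _ _ => rfl) fs _)

theorem genAll_andL₂ {A' B' : Fma At} {Γ Θ : Cxt At} (hΘ : Θ = Γ ++ Δ) :
    {Qs : List (Fma At)} → (hA : A.conj = Qs) → (fs : All (LI none (some B') Γ) Qs) →
      genAll r hΘ hA (fs.map fun _ => LI.andL₂LI) =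
        (genAll r hΘ hA fs).andL₂LI (A := A')
  | _, hA, .nil => absurd hA A.conj_ne_nil
  | _, hA, .cons f fs => by
      have e : ((fs.map fun _ => LI.andL₂LI).map fun _ => LI.invF (irr_and A' B')) =
          fs.map fun _ f => .andL₂ (ann_none _) f.nonNeg f := All.map_map _ _ fs
      have hv := tags_map_const (t := .C₂)
        (k := fun P (f : LI none (some B') Γ P) => .andL₂ (A := A') (ann_none _) f.nonNeg f)
        (fun _ _ => rfl) fs
      simp only [genAll, All.map, LI.andL₂LI, genLI]
      rw [e, genFo_andL₂ r hA hΘ _ _ _ _ _ hv]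
      exact congrArg (fun gs => (genLI r hA hΘ f gs).andL₂LI)
        (invAll_map (fun _ => Fo.invAndL₂) (fun _ _ _ => rfl) fs _)

namespace RightRule

variable {Γ Θ : Cxt At} (hΘ : Θ = Γ ++ Δ)

theorem applyRI_passRI {A' : Fma At} (hΘ' : A' :: Θ = A' :: Γ ++ Δ)
    (f : RI none (some A') Γ A) :
    r.applyRI hΘ' (RI.passRI f) = RI.passRI (r.applyRI hΘ f) := by
  simp only [applyRI, RI.invert_passRI, genAll_pass r hΘ hΘ', RI.passRI]
  rfl

theorem applyRI_andL₁RI {A' B' : Fma At} (f : RI none (some A') Γ A) :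
    r.applyRI hΘ (RI.andL₁RI (B := B') f) = RI.andL₁RI (r.applyRI hΘ f) := by
  simp only [applyRI, RI.invert_andL₁RI, genAll_andL₁ r hΘ, RI.andL₁RI]
  rfl

theorem applyRI_andL₂RI {A' B' : Fma At} (f : RI none (some B') Γ A) :
    r.applyRI hΘ (RI.andL₂RI (A := A') f) = RI.andL₂RI (r.applyRI hΘ f) := by
  simp only [applyRI, RI.invert_andL₂RI, genAll_andL₂ r hΘ, RI.andL₂RI]
  rfl

theorem applyRI_ILRI (f : RI none none Γ A) :
    r.applyRI hΘ (RI.ILRI f) = RI.ILRI (r.applyRI hΘ f) := by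
  simp only [applyRI, genAll_IL r hΘ, RI.invert_ILRI, RI.ILRI]

theorem applyRI_tensorLRI {A' B' : Fma At} (hΘ' : B' :: Θ = B' :: Γ ++ Δ)
    (f : RI none (some A') (B' :: Γ) A) :
    r.applyRI hΘ (RI.tensorLRI f) = RI.tensorLRI (r.applyRI hΘ' f) := by
  simp only [applyRI, genAll_tensorL r hΘ hΘ', RI.invert_tensorLRI, RI.tensorLRI]

theorem applyRI_orLRI {A' B' : Fma At} (f : RI none (some A') Γ A)
    (g : RI none (some B') Γ A) :
    r.applyRI hΘ (RI.orLRI f g) = RI.orLRI (r.applyRI hΘ f) (r.applyRI hΘ g) := by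
  simp only [applyRI, genAll_orL r hΘ, RI.invert_orLRI₁, RI.invert_orLRI₂, RI.orLRI]

end RightRule

end

theorem focus_eq_of_cong {S : Stoup At} {Γ : Cxt At} {A : Fma At} {f g : Der S Γ A}
    (h : Cong f g) : focus f = focus g := by
  induction h with
  | refl => rfl
  | symm _ ih => exact ih.symm
  | trans _ _ ih₁ ih₂ => exact ih₁.trans ih₂
  | pass _ ih | IL _ ih | tensorL _ ih | andL₁ _ ih | andL₂ _ ih | orR₁ _ ih | orR₂ _ ih =>
      simp only [focus, ih]
  | tensorR _ _ _ ih₁ ih₂ | andR _ _ ih₁ ih₂ | orL _ _ ih₁ ih₂ => simp only [focus, ih₁, ih₂]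
  | ax_unit | ax_tensor | ax_and | ax_or => simp only [focus, RI.axRI]
  | tensorR_pass => exact RightRule.applyRI_passRI _ _ _ _
  | tensorR_IL => exact RightRule.applyRI_ILRI _ _ _
  | tensorR_tensorL => exact RightRule.applyRI_tensorLRI _ _ _ _
  | tensorR_andL₁ => exact RightRule.applyRI_andL₁RI _ _ _
  | tensorR_andL₂ => exact RightRule.applyRI_andL₂RI _ _ _
  | tensorR_orL => exact RightRule.applyRI_orLRI _ _ _ _
  | pass_andR | IL_andR | tensorL_andR | andL₁_andR | andL₂_andR | orL_andR => rfl
  | orR₁_pass | orR₂_pass => exact RightRule.applyRI_passRI _ _ _ _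
  | orR₁_IL | orR₂_IL => exact RightRule.applyRI_ILRI _ _ _
  | orR₁_tensorL | orR₂_tensorL => exact RightRule.applyRI_tensorLRI _ _ _ _
  | orR₁_andL₁ | orR₂_andL₁ => exact RightRule.applyRI_andL₁RI _ _ _
  | orR₁_andL₂ | orR₂_andL₂ => exact RightRule.applyRI_andL₂RI _ _ _
  | orR₁_orL | orR₂_orL => exact RightRule.applyRI_orLRI _ _ _ _

/-! ### The iterated right conjunction rule -/

/-- The iterated right conjunction rule on unfocused derivations. -/
def andRStar {S : Stoup At} {Γ : Cxt At} : (A : Fma At) → All (Der S Γ) A.conj → Der S Γ A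
  | .and A B, fs => .andR (andRStar A (fs.fst A.conj)) (andRStar B (fs.snd A.conj))
  | .atom _, .cons f .nil => f
  | .unit, .cons f .nil => f
  | .tensor _ _, .cons f .nil => f
  | .or _ _, .cons f .nil => f

theorem andRStar_single {S : Stoup At} {Γ : Cxt At} : {P : Fma At} → (hP : P.NonNeg) →
    (f : Der S Γ P) → andRStar P (.single hP f) = f
  | .atom _, _, _ => rfl
  | .unit, _, _ => rfl
  | .tensor _ _, _, _ => rfl
  | .or _ _, _, _ => rfl

theorem andRStar_append {S : Stoup At} {Γ : Cxt At} {A B : Fma At}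
    (fs : All (Der S Γ) A.conj) (gs : All (Der S Γ) B.conj) :
    andRStar (.and A B) (fs.append gs) = .andR (andRStar A fs) (andRStar B gs) :=
  congrArg₂ (fun fs gs => Der.andR (andRStar A fs) (andRStar B gs))
    (All.fst_append fs gs) (All.snd_append fs gs)

theorem andRStar_map_fst_snd {p : Fma At → Type u} {S : Stoup At} {Γ : Cxt At} {A B : Fma At}
    (k : ∀ P, p P → Der S Γ P) (xs : All p (Fma.and A B).conj) :
    andRStar (.and A B) (xs.map k) =
      .andR (andRStar A ((xs.fst A.conj).map k)) (andRStar B ((xs.snd A.conj).map k)) := by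
  rw [andRStar]
  exact congrArg₂ (fun fs gs => Der.andR (andRStar A fs) (andRStar B gs))
    (All.map_fst k A.conj xs) (All.map_snd k A.conj xs)

theorem andRStar_invert {S : Stoup At} {Γ : Cxt At} : {A : Fma At} → (f : RI none S Γ A) →
    andRStar A (f.invert.map fun _ => embLI) = embRI f
  | _, .andR f g => by
      rw [RI.invert, All.map_append_conj, andRStar_append, andRStar_invert f,
        andRStar_invert g, embRI]
  | _, .li2ri hP f => by rw [RI.invert, All.map_single, andRStar_single, embRI]

theorem embFo_tagged {o : Option Tag} {S : Stoup At} {Γ : Cxt At} {P : Fma At} :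
    (f : Fo o S Γ P) → embFo f.tagged = embFo f
  | .pass _ _ _ => rfl
  | .andL₁ _ _ _ => rfl
  | .andL₂ _ _ _ => rfl
  | .ax _ => rfl
  | .IR _ => rfl
  | .tensorR _ _ _ _ _ _ => rfl
  | .orR₁ _ _ _ _ => rfl
  | .orR₂ _ _ _ _ => rfl

theorem embRI_andRStarT {T : Stoup At} {Γ : Cxt At} (hT : Irr T) :
    (A : Fma At) → (fs : All (Fo none T Γ) A.conj) →
      embRI (andRStarT hT A fs) = andRStar A (fs.map fun _ => embFo)
  | .and A B, fs => by
      rw [andRStar_map_fst_snd, ← embRI_andRStarT hT A, ← embRI_andRStarT hT B]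
      rfl
  | .atom _, .cons f .nil => embFo_tagged f
  | .unit, .cons f .nil => embFo_tagged f
  | .tensor _ _, .cons f .nil => embFo_tagged f
  | .or _ _, .cons f .nil => embFo_tagged f

/-- A one-premise left rule that commutes with the right conjunction rule commutes with the
iterated one. -/
theorem cong_andRStar_map {p : Fma At → Type u} {S S' : Stoup At} {Γ Γ' : Cxt At}
    (L : ∀ P, Der S Γ P → Der S' Γ' P)
    (hL : ∀ A B (f : Der S Γ A) (g : Der S Γ B),
      Cong (L _ (.andR f g)) (.andR (L _ f) (L _ g)))
    (k : ∀ P, p P → Der S Γ P) : (A : Fma At) → (xs : All p A.conj) →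
      Cong (andRStar A (xs.map fun P x => L P (k P x))) (L A (andRStar A (xs.map k)))
  | .and A B, xs => by
      rw [andRStar_map_fst_snd, andRStar_map_fst_snd]
      exact (Cong.andR (cong_andRStar_map L hL k A _) (cong_andRStar_map L hL k B _)).trans
        (hL _ _ _ _).symm
  | .atom _, .cons _ .nil => .refl _
  | .unit, .cons _ .nil => .refl _
  | .tensor _ _, .cons _ .nil => .refl _
  | .or _ _, .cons _ .nil => .refl _

theorem cong_andRStar_map_orL {p : Fma At → Type u} {A' B' : Fma At} {Γ : Cxt At}
    (k₁ : ∀ P, p P → Der (some A') Γ P) (k₂ : ∀ P, p P → Der (some B') Γ P) :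
    (A : Fma At) → (xs : All p A.conj) →
      Cong (andRStar A (xs.map fun P x => .orL (k₁ P x) (k₂ P x)))
        (.orL (andRStar A (xs.map k₁)) (andRStar A (xs.map k₂)))
  | .and A B, xs => by
      rw [andRStar_map_fst_snd, andRStar_map_fst_snd, andRStar_map_fst_snd]
      exact (Cong.andR (cong_andRStar_map_orL k₁ k₂ A _)
        (cong_andRStar_map_orL k₁ k₂ B _)).trans (Cong.orL_andR _ _ _ _).symm
  | .atom _, .cons _ .nil => .refl _
  | .unit, .cons _ .nil => .refl _
  | .tensor _ _, .cons _ .nil => .refl _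
  | .or _ _, .cons _ .nil => .refl _

/-! ### Embedding the generalized right rules -/

/-- Applying a right non-invertible rule to an unfocused derivation. -/
def RightRule.der {S : Stoup At} {Γ Θ : Cxt At} :
    {A C : Fma At} → {Δ : Cxt At} → RightRule A C Δ → Θ = Γ ++ Δ → Der S Γ A → Der S Θ C
  | _, _, _, .tensorR g, h, f => .tensorR h f (embRI g)
  | _, _, _, .orR₁, h, f =>
      match Θ, h.trans (List.append_nil Γ) with
      | _, rfl => .orR₁ f
  | _, _, _, .orR₂, h, f =>
      match Θ, h.trans (List.append_nil Γ) with
      | _, rfl => .orR₂ f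

namespace RightRule

variable {A C : Fma At} {Δ : Cxt At} (r : RightRule A C Δ)

theorem embFo_fire {T : Stoup At} {Γ Θ : Cxt At} {l : List Tag} (hT : Irr T) (hl : Valid l)
    (hΘ : Θ = Γ ++ Δ) (f : RI (some l) T Γ A) :
    embFo (r.fire hT hl hΘ f) = r.der hΘ (embRI f) := by
  cases r with
  | tensorR g => rfl
  | orR₁ | orR₂ =>
      obtain rfl := hΘ.trans (List.append_nil Γ)
      rfl

theorem cong_der {S : Stoup At} {Γ Θ : Cxt At} (hΘ : Θ = Γ ++ Δ) {f g : Der S Γ A}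
    (h : Cong f g) : Cong (r.der hΘ f) (r.der hΘ g) := by
  cases r with
  | tensorR _ => exact .tensorR hΘ h (.refl _)
  | orR₁ =>
      obtain rfl := hΘ.trans (List.append_nil Γ)
      exact .orR₁ h
  | orR₂ =>
      obtain rfl := hΘ.trans (List.append_nil Γ)
      exact .orR₂ h

variable {Γ Θ : Cxt At} (hΘ : Θ = Γ ++ Δ)

theorem der_pass {A' : Fma At} (hΘ' : A' :: Θ = A' :: Γ ++ Δ) (f : Der (some A') Γ A) :
    Cong (r.der hΘ' (.pass f)) (.pass (r.der hΘ f)) := by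
  cases r with
  | tensorR _ => subst hΘ; exact .tensorR_pass _ _
  | orR₁ =>
      obtain rfl := hΘ.trans (List.append_nil Γ)
      exact .orR₁_pass _
  | orR₂ =>
      obtain rfl := hΘ.trans (List.append_nil Γ)
      exact .orR₂_pass _

theorem der_IL (f : Der none Γ A) : Cong (r.der hΘ (.IL f)) (.IL (r.der hΘ f)) := by
  cases r with
  | tensorR _ => subst hΘ; exact .tensorR_IL _ _
  | orR₁ =>
      obtain rfl := hΘ.trans (List.append_nil Γ)
      exact .orR₁_IL _
  | orR₂ =>
      obtain rfl := hΘ.trans (List.append_nil Γ)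
      exact .orR₂_IL _

theorem der_tensorL {A' B' : Fma At} (hΘ' : B' :: Θ = B' :: Γ ++ Δ)
    (f : Der (some A') (B' :: Γ) A) :
    Cong (r.der hΘ (.tensorL f)) (.tensorL (r.der hΘ' f)) := by
  cases r with
  | tensorR _ => subst hΘ; exact .tensorR_tensorL _ _
  | orR₁ =>
      obtain rfl := hΘ.trans (List.append_nil Γ)
      exact .orR₁_tensorL _
  | orR₂ =>
      obtain rfl := hΘ.trans (List.append_nil Γ)
      exact .orR₂_tensorL _

theorem der_andL₁ {A' B' : Fma At} (f : Der (some A') Γ A) :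
    Cong (r.der hΘ (.andL₁ (B := B') f)) (.andL₁ (r.der hΘ f)) := by
  cases r with
  | tensorR _ => subst hΘ; exact .tensorR_andL₁ _ _
  | orR₁ =>
      obtain rfl := hΘ.trans (List.append_nil Γ)
      exact .orR₁_andL₁ _
  | orR₂ =>
      obtain rfl := hΘ.trans (List.append_nil Γ)
      exact .orR₂_andL₁ _

theorem der_andL₂ {A' B' : Fma At} (f : Der (some B') Γ A) :
    Cong (r.der hΘ (.andL₂ (A := A') f)) (.andL₂ (r.der hΘ f)) := by
  cases r with
  | tensorR _ => subst hΘ; exact .tensorR_andL₂ _ _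
  | orR₁ =>
      obtain rfl := hΘ.trans (List.append_nil Γ)
      exact .orR₁_andL₂ _
  | orR₂ =>
      obtain rfl := hΘ.trans (List.append_nil Γ)
      exact .orR₂_andL₂ _

theorem der_orL {A' B' : Fma At} (f : Der (some A') Γ A) (g : Der (some B') Γ A) :
    Cong (r.der hΘ (.orL f g)) (.orL (r.der hΘ f) (r.der hΘ g)) := by
  cases r with
  | tensorR _ => subst hΘ; exact .tensorR_orL _ _ _
  | orR₁ =>
      obtain rfl := hΘ.trans (List.append_nil Γ)
      exact .orR₁_orL _ _
  | orR₂ =>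
      obtain rfl := hΘ.trans (List.append_nil Γ)
      exact .orR₂_orL _ _

/-- Applying a right non-invertible rule to the iterated right conjunction of a list. -/
def derAll {S : Stoup At} {Γ Θ : Cxt At} (hΘ : Θ = Γ ++ Δ) {Qs : List (Fma At)}
    (hA : A.conj = Qs) (fs : All (Der S Γ) Qs) : Der S Θ C :=
  match Qs, hA, fs with
  | _, rfl, fs => r.der hΘ (andRStar A fs)

theorem embFo_fireAll {T : Stoup At} {Γ Θ : Cxt At} {Qs : List (Fma At)} (hA : A.conj = Qs)
    (hΘ : Θ = Γ ++ Δ) (hT : Irr T) (fs : All (Fo none T Γ) Qs) (hl : Valid (tags fs)) :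
    embFo (r.fireAll hA hΘ hT fs hl) = r.derAll hΘ hA (fs.map fun _ => embFo) := by
  subst hA
  exact (r.embFo_fire hT hl hΘ _).trans (congrArg _ (embRI_andRStarT hT A fs))

theorem cong_embFo_genFo_of_valid {P : Fma At} {Ps : List (Fma At)} (hA : A.conj = P :: Ps)
    {T : Stoup At} {Γ Θ : Cxt At} (hT : Irr T) (hΘ : Θ = Γ ++ Δ) (f : Fo none T Γ P)
    (fs : All (Fo none T Γ) Ps) (hl : Valid (tags (.cons f fs))) :
    Cong (embFo (genFo r hA hT hΘ f fs))
      (r.derAll hΘ hA ((All.cons f fs).map fun _ => embFo)) := by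
  rw [genFo_of_valid r hA hT hΘ f fs hl, r.embFo_fireAll]
  exact .refl _

theorem derAll_map {S S' : Stoup At} {Γ Γ' Θ Θ' : Cxt At} (hΘ : Θ = Γ ++ Δ)
    (hΘ' : Θ' = Γ' ++ Δ) (L : ∀ P, Der S Γ P → Der S' Γ' P) (L' : Der S Θ C → Der S' Θ' C)
    (hL : ∀ A B (f : Der S Γ A) (g : Der S Γ B),
      Cong (L _ (.andR f g)) (.andR (L _ f) (L _ g)))
    (hL' : ∀ f, Cong (r.der hΘ' (L A f)) (L' (r.der hΘ f)))
    {p : Fma At → Type u} (k : ∀ P, p P → Der S Γ P) (k' : ∀ P, p P → Der S' Γ' P)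
    (hk : ∀ P x, k' P x = L P (k P x)) {Qs : List (Fma At)} (hA : A.conj = Qs) (xs : All p Qs) :
    Cong (r.derAll hΘ' hA (xs.map k')) (L' (r.derAll hΘ hA (xs.map k))) := by
  subst hA
  rw [All.map_congr hk]
  exact (r.cong_der hΘ' (cong_andRStar_map L hL k A xs)).trans (hL' _)

theorem derAll_map_orL {A' B' : Fma At} {p : Fma At → Type u}
    (k₁ : ∀ P, p P → Der (some A') Γ P) (k₂ : ∀ P, p P → Der (some B') Γ P)
    (k : ∀ P, p P → Der (some (.or A' B')) Γ P) (hk : ∀ P x, k P x = .orL (k₁ P x) (k₂ P x))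
    {Qs : List (Fma At)} (hA : A.conj = Qs) (xs : All p Qs) :
    Cong (r.derAll hΘ hA (xs.map k))
      (.orL (r.derAll hΘ hA (xs.map k₁)) (r.derAll hΘ hA (xs.map k₂))) := by
  subst hA
  rw [All.map_congr hk]
  exact (r.cong_der hΘ (cong_andRStar_map_orL k₁ k₂ A xs)).trans (r.der_orL hΘ _ _)

end RightRule

theorem map_invAll {q : Fma At → Type u} {S S' : Stoup At} {Γ Γ' : Cxt At} {t : Tag}
    (k : ∀ P, (f : Fo none S Γ P) → f.tag = t → LI none S' Γ' P)
    (j : ∀ P, LI none S' Γ' P → q P) (j' : ∀ P, Fo none S Γ P → q P)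
    (hk : ∀ P f h, j P (k P f h) = j' P f) :
    {Ps : List (Fma At)} → (fs : All (Fo none S Γ) Ps) → (h : ∀ s ∈ tags fs, s = t) →
      (invAll k fs h).map j = fs.map j'
  | _, .nil, _ => rfl
  | _, .cons f fs, _ => by simp only [All.map, invAll, hk, map_invAll k j j' hk fs]

theorem LI.embLI_invIL {Γ : Cxt At} {P : Fma At} :
    (f : LI none (some .unit) Γ P) → embLI f = .IL (embLI f.invIL)
  | .IL _ _ => rfl
  | .f2li _ hT _ => False.elim hT

theorem LI.embLI_invTensorL {A B : Fma At} {Γ : Cxt At} {P : Fma At} :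
    (f : LI none (some (.tensor A B)) Γ P) → embLI f = .tensorL (embLI f.invTensorL)
  | .tensorL _ _ => rfl
  | .f2li _ hT _ => False.elim hT

theorem LI.embLI_invOrL {A B : Fma At} {Γ : Cxt At} {P : Fma At} :
    (f : LI none (some (.or A B)) Γ P) → embLI f = .orL (embLI f.invOrL₁) (embLI f.invOrL₂)
  | .orL _ _ _ => rfl
  | .f2li _ hT _ => False.elim hT

theorem LI.embFo_invF : {T : Stoup At} → {Γ : Cxt At} → {P : Fma At} → (hT : Irr T) →
    (f : LI none T Γ P) → embFo (f.invF hT) = embLI f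
  | _, _, _, _, .f2li _ _ _ => rfl
  | _, _, _, hT, .IL _ _ => False.elim hT
  | _, _, _, hT, .tensorL _ _ => False.elim hT
  | _, _, _, hT, .orL _ _ _ => False.elim hT

theorem Fo.embLI_invPass {A : Fma At} {Γ : Cxt At} {P : Fma At} :
    (f : Fo none none (A :: Γ) P) → (h : f.tag = .P) → embFo f = .pass (embLI (f.invPass h))
  | .pass _ _ _, _ => rfl
  | .tensorR _ _ _ _ _ _, h => Tag.noConfusion h
  | .orR₁ _ _ _ _, h => Tag.noConfusion h
  | .orR₂ _ _ _ _, h => Tag.noConfusion h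

theorem Fo.embLI_invAndL₁ {A B : Fma At} {Γ : Cxt At} {P : Fma At} :
    (f : Fo none (some (.and A B)) Γ P) → (h : f.tag = .C₁) →
      embFo f = .andL₁ (embLI (f.invAndL₁ h))
  | .andL₁ _ _ _, _ => rfl
  | .andL₂ _ _ _, h => Tag.noConfusion h
  | .tensorR _ _ _ _ _ _, h => Tag.noConfusion h
  | .orR₁ _ _ _ _, h => Tag.noConfusion h
  | .orR₂ _ _ _ _, h => Tag.noConfusion h

theorem Fo.embLI_invAndL₂ {A B : Fma At} {Γ : Cxt At} {P : Fma At} :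
    (f : Fo none (some (.and A B)) Γ P) → (h : f.tag = .C₂) →
      embFo f = .andL₂ (embLI (f.invAndL₂ h))
  | .andL₂ _ _ _, _ => rfl
  | .andL₁ _ _ _, h => Tag.noConfusion h
  | .tensorR _ _ _ _ _ _, h => Tag.noConfusion h
  | .orR₁ _ _ _ _, h => Tag.noConfusion h
  | .orR₂ _ _ _ _, h => Tag.noConfusion h

section

variable {A C : Fma At} {Δ : Cxt At} (r : RightRule A C Δ)

theorem invAll_forget {S S' : Stoup At} {Γ Γ' : Cxt At} {t : Tag}
    (k : ∀ P, (f : Fo none S Γ P) → f.tag = t → LI none S' Γ' P)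
    (L : ∀ P, Der S' Γ' P → Der S Γ P)
    (hk : ∀ P (f : Fo none S Γ P) h, embFo f = L P (embLI (k P f h)))
    {Ps : List (Fma At)} (fs : All (Fo none S Γ) Ps) (h : ∀ s ∈ tags fs, s = t) :
    (fs.map fun _ => embFo) = (invAll k fs h).map fun P f => L P (embLI f) :=
  (map_invAll k _ _ (fun P f h => (hk P f h).symm) fs h).symm

mutual

theorem cong_embLI_genLI {P : Fma At} {Ps : List (Fma At)} (hA : A.conj = P :: Ps) :
    {S : Stoup At} → {Γ Θ : Cxt At} → (hΘ : Θ = Γ ++ Δ) →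
    (f : LI none S Γ P) → (fs : All (LI none S Γ) Ps) →
    Cong (embLI (genLI r hA hΘ f fs)) (r.derAll hΘ hA ((All.cons f fs).map fun _ => embLI))
  | _, _, _, hΘ, .IL hP f, fs => by
      rw [genLI, embLI]
      refine (Cong.IL (cong_embLI_genLI hA hΘ f _)).trans ?_
      have := r.derAll_map hΘ hΘ (fun _ => Der.IL) Der.IL (fun _ _ _ _ => .IL_andR _ _)
        (r.der_IL hΘ) (fun _ f => embLI (LI.invIL f)) (fun _ => embLI)
        (fun _ => LI.embLI_invIL) hA (.cons (.IL hP f) fs)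
      rw [All.map, All.map_map]
      exact this.symm
  | _, _, _, hΘ, .tensorL hP f, fs => by
      rw [genLI, embLI]
      refine (Cong.tensorL (cong_embLI_genLI hA (congrArg (List.cons _) hΘ) f _)).trans ?_
      have := r.derAll_map (congrArg (List.cons _) hΘ) hΘ (fun _ => Der.tensorL) Der.tensorL
        (fun _ _ _ _ => .tensorL_andR _ _)
        (r.der_tensorL hΘ _) (fun _ f => embLI (LI.invTensorL f)) (fun _ => embLI)
        (fun _ => LI.embLI_invTensorL) hA (.cons (.tensorL hP f) fs)
      rw [All.map, All.map_map]
      exact this.symm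
  | _, _, _, hΘ, .orL hP f g, fs => by
      rw [genLI, embLI]
      refine (Cong.orL (cong_embLI_genLI hA hΘ f _) (cong_embLI_genLI hA hΘ g _)).trans ?_
      have := r.derAll_map_orL hΘ (fun _ f => embLI (LI.invOrL₁ f))
        (fun _ f => embLI (LI.invOrL₂ f)) (fun _ => embLI)
        (fun _ => LI.embLI_invOrL) hA (.cons (.orL hP f g) fs)
      rw [All.map, All.map, All.map_map, All.map_map]
      exact this.symm
  | _, _, _, hΘ, .f2li hP hT f, fs => by
      rw [genLI, embLI]
      refine (cong_embFo_genFo hA hT hΘ f _).trans ?_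
      rw [All.map, All.map_map, All.map_congr (fun _ => LI.embFo_invF hT)]
      exact .refl _

theorem cong_embFo_genFo : {P : Fma At} → {Ps : List (Fma At)} → (hA : A.conj = P :: Ps) →
    {T : Stoup At} → {Γ Θ : Cxt At} → (hT : Irr T) →
    (hΘ : Θ = Γ ++ Δ) → (f : Fo none T Γ P) → (fs : All (Fo none T Γ) Ps) →
    Cong (embFo (genFo r hA hT hΘ f fs)) (r.derAll hΘ hA ((All.cons f fs).map fun _ => embFo))
  | _, _, hA, _, A' :: Γ, Θ, hT, hΘ, .pass ho hP f, fs => by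
      by_cases hl : Valid (.P :: tags fs)
      · exact r.cong_embFo_genFo_of_valid hA hT hΘ _ fs hl
      · have h := tags_pass fs hl
        obtain ⟨Θ', hΘ', rfl⟩ : ∃ Θ', Θ' = Γ ++ Δ ∧ Θ = A' :: Θ' := ⟨_, rfl, hΘ⟩
        rw [genFo_pass r hA hΘ' hΘ hT ho hP f fs h, embFo, All.map,
          invAll_forget (fun _ => Fo.invPass) (fun _ => Der.pass) (fun _ => Fo.embLI_invPass) fs h]
        exact (Cong.pass (cong_embLI_genLI hA hΘ' f _)).trans
          (r.derAll_map hΘ' hΘ (fun _ => Der.pass) Der.pass (fun _ _ _ _ => .pass_andR _ _)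
            (r.der_pass hΘ' hΘ) (fun _ => embLI) _ (fun _ _ => rfl) hA (.cons f _)).symm
  | _, _, hA, _, _, _, hT, hΘ, .andL₁ ho hP f, fs => by
      by_cases hl : Valid (.C₁ :: tags fs)
      · exact r.cong_embFo_genFo_of_valid hA hT hΘ _ fs hl
      · have h := tags_andL₁ fs hl
        rw [genFo_andL₁ r hA hΘ hT ho hP f fs h, embFo, All.map,
          invAll_forget (fun _ => Fo.invAndL₁) (fun _ => Der.andL₁)
            (fun _ => Fo.embLI_invAndL₁) fs h]
        exact (Cong.andL₁ (cong_embLI_genLI hA hΘ f _)).trans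
          (r.derAll_map hΘ hΘ (fun _ => Der.andL₁) Der.andL₁ (fun _ _ _ _ => .andL₁_andR _ _)
            (r.der_andL₁ hΘ) (fun _ => embLI) _ (fun _ _ => rfl) hA (.cons f _)).symm
  | _, _, hA, _, _, _, hT, hΘ, .andL₂ ho hP f, fs => by
      by_cases hl : Valid (.C₂ :: tags fs)
      · exact r.cong_embFo_genFo_of_valid hA hT hΘ _ fs hl
      · have h := tags_andL₂ fs hl
        rw [genFo_andL₂ r hA hΘ hT ho hP f fs h, embFo, All.map,
          invAll_forget (fun _ => Fo.invAndL₂) (fun _ => Der.andL₂)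
            (fun _ => Fo.embLI_invAndL₂) fs h]
        exact (Cong.andL₂ (cong_embLI_genLI hA hΘ f _)).trans
          (r.derAll_map hΘ hΘ (fun _ => Der.andL₂) Der.andL₂ (fun _ _ _ _ => .andL₂_andR _ _)
            (r.der_andL₂ hΘ) (fun _ => embLI) _ (fun _ _ => rfl) hA (.cons f _)).symm
  | _, _, hA, _, _, _, hT, hΘ, .ax ho, fs =>
      r.cong_embFo_genFo_of_valid hA hT hΘ _ fs (valid_R _)
  | _, _, hA, _, _, _, hT, hΘ, .IR ho, fs =>
      r.cong_embFo_genFo_of_valid hA hT hΘ _ fs (valid_R _)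
  | _, _, hA, _, _, _, hT, hΘ, .tensorR ho hT' h hl f g, fs =>
      r.cong_embFo_genFo_of_valid hA hT hΘ _ fs (valid_R _)
  | _, _, hA, _, _, _, hT, hΘ, .orR₁ ho hT' hl f, fs =>
      r.cong_embFo_genFo_of_valid hA hT hΘ _ fs (valid_R _)
  | _, _, hA, _, _, _, hT, hΘ, .orR₂ ho hT' hl f, fs =>
      r.cong_embFo_genFo_of_valid hA hT hΘ _ fs (valid_R _)

end

theorem cong_embLI_genAll {S : Stoup At} {Γ Θ : Cxt At} (hΘ : Θ = Γ ++ Δ) :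
    {Qs : List (Fma At)} → (hA : A.conj = Qs) → (fs : All (LI none S Γ) Qs) →
      Cong (embLI (genAll r hΘ hA fs)) (r.derAll hΘ hA (fs.map fun _ => embLI))
  | _, hA, .nil => absurd hA A.conj_ne_nil
  | _, hA, .cons f fs => cong_embLI_genLI r hA hΘ f fs

theorem RightRule.cong_embRI_applyRI {S : Stoup At} {Γ Θ : Cxt At} (hΘ : Θ = Γ ++ Δ)
    (f : RI none S Γ A) : Cong (embRI (r.applyRI hΘ f)) (r.der hΘ (embRI f)) := by
  rw [← andRStar_invert f]
  exact cong_embLI_genAll r hΘ rfl f.invert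

end

/-! ### Embedding the admissible rules -/

theorem cong_embRI_passRI {A : Fma At} {Γ : Cxt At} : {C : Fma At} →
    (f : RI none (some A) Γ C) → Cong (embRI (RI.passRI f)) (.pass (embRI f))
  | _, .andR f g => (Cong.andR (cong_embRI_passRI f) (cong_embRI_passRI g)).trans
      (Cong.pass_andR _ _).symm
  | _, .li2ri _ _ => by
      rw [RI.passRI]
      exact .refl _

theorem cong_embRI_ILRI {Γ : Cxt At} : {C : Fma At} →
    (f : RI none none Γ C) → Cong (embRI (RI.ILRI f)) (.IL (embRI f))
  | _, .andR f g => (Cong.andR (cong_embRI_ILRI f) (cong_embRI_ILRI g)).trans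
      (Cong.IL_andR _ _).symm
  | _, .li2ri _ _ => by
      rw [RI.ILRI]
      exact .refl _

theorem cong_embRI_tensorLRI {A B : Fma At} {Γ : Cxt At} : {C : Fma At} →
    (f : RI none (some A) (B :: Γ) C) → Cong (embRI (RI.tensorLRI f)) (.tensorL (embRI f))
  | _, .andR f g => (Cong.andR (cong_embRI_tensorLRI f) (cong_embRI_tensorLRI g)).trans
      (Cong.tensorL_andR _ _).symm
  | _, .li2ri _ _ => by
      rw [RI.tensorLRI]
      exact .refl _

theorem cong_embRI_andL₁RI {A B : Fma At} {Γ : Cxt At} : {C : Fma At} →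
    (f : RI none (some A) Γ C) → Cong (embRI (RI.andL₁RI (B := B) f)) (.andL₁ (embRI f))
  | _, .andR f g => (Cong.andR (cong_embRI_andL₁RI f) (cong_embRI_andL₁RI g)).trans
      (Cong.andL₁_andR _ _).symm
  | _, .li2ri _ _ => by
      rw [RI.andL₁RI]
      exact .refl _

theorem cong_embRI_andL₂RI {A B : Fma At} {Γ : Cxt At} : {C : Fma At} →
    (f : RI none (some B) Γ C) → Cong (embRI (RI.andL₂RI (A := A) f)) (.andL₂ (embRI f))
  | _, .andR f g => (Cong.andR (cong_embRI_andL₂RI f) (cong_embRI_andL₂RI g)).trans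
      (Cong.andL₂_andR _ _).symm
  | _, .li2ri _ _ => by
      rw [RI.andL₂RI]
      exact .refl _

theorem cong_embRI_orLRI {A B : Fma At} {Γ : Cxt At} : {C : Fma At} →
    (f : RI none (some A) Γ C) → (g : RI none (some B) Γ C) →
      Cong (embRI (RI.orLRI f g)) (.orL (embRI f) (embRI g))
  | _, .andR f f', .andR g g' => by
      rw [RI.orLRI]
      exact (Cong.andR (cong_embRI_orLRI f g) (cong_embRI_orLRI f' g')).trans
        (Cong.orL_andR _ _ _ _).symm
  | _, .li2ri _ _, .li2ri _ _ => by
      rw [RI.orLRI]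
      exact .refl _
  | _, .andR _ _, .li2ri hP _ => False.elim hP
  | _, .li2ri hP _, .andR _ _ => False.elim hP

theorem cong_embRI_tensorRRI {S : Stoup At} {Γ Δ Θ : Cxt At} {A B : Fma At} (h : Θ = Γ ++ Δ)
    (f : RI none S Γ A) (g : RI none none Δ B) :
    Cong (embRI (RI.tensorRRI h f g)) (.tensorR h (embRI f) (embRI g)) :=
  (RightRule.tensorR g).cong_embRI_applyRI h f

theorem cong_embRI_orR₁RI {S : Stoup At} {Γ : Cxt At} {A B : Fma At} (f : RI none S Γ A) :
    Cong (embRI (RI.orR₁RI (B := B) f)) (.orR₁ (embRI f)) :=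
  RightRule.orR₁.cong_embRI_applyRI (List.append_nil Γ).symm f

theorem cong_embRI_orR₂RI {S : Stoup At} {Γ : Cxt At} {A B : Fma At} (f : RI none S Γ B) :
    Cong (embRI (RI.orR₂RI (A := A) f)) (.orR₂ (embRI f)) :=
  RightRule.orR₂.cong_embRI_applyRI (List.append_nil Γ).symm f

theorem cong_embRI_axRI : (A : Fma At) → Cong (embRI (RI.axRI A)) .ax
  | .atom _ => .refl _
  | .unit => (cong_embRI_ILRI _).trans Cong.ax_unit.symm
  | .tensor A B =>
      (cong_embRI_tensorLRI _).trans ((Cong.tensorL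
        ((cong_embRI_tensorRRI rfl _ _).trans
          (Cong.tensorR rfl (cong_embRI_axRI A)
            ((cong_embRI_passRI _).trans (Cong.pass (cong_embRI_axRI B)))))).trans
        Cong.ax_tensor.symm)
  | .and A B =>
      (Cong.andR ((cong_embRI_andL₁RI _).trans (Cong.andL₁ (cong_embRI_axRI A)))
        ((cong_embRI_andL₂RI _).trans (Cong.andL₂ (cong_embRI_axRI B)))).trans Cong.ax_and.symm
  | .or A B =>
      (cong_embRI_orLRI _ _).trans ((Cong.orL
        ((cong_embRI_orR₁RI _).trans (Cong.orR₁ (cong_embRI_axRI A)))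
        ((cong_embRI_orR₂RI _).trans (Cong.orR₂ (cong_embRI_axRI B)))).trans
        Cong.ax_or.symm)

theorem cong_embRI_focus : {S : Stoup At} → {Γ : Cxt At} → {A : Fma At} → (f : Der S Γ A) →
    Cong (embRI (focus f)) f
  | _, _, _, .ax => cong_embRI_axRI _
  | _, _, _, .pass f => (cong_embRI_passRI _).trans (.pass (cong_embRI_focus f))
  | _, _, _, .IL f => (cong_embRI_ILRI _).trans (.IL (cong_embRI_focus f))
  | _, _, _, .IR => .refl _
  | _, _, _, .tensorL f => (cong_embRI_tensorLRI _).trans (.tensorL (cong_embRI_focus f))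
  | _, _, _, .tensorR h f g => (cong_embRI_tensorRRI h _ _).trans
      (.tensorR h (cong_embRI_focus f) (cong_embRI_focus g))
  | _, _, _, .andL₁ f => (cong_embRI_andL₁RI _).trans (.andL₁ (cong_embRI_focus f))
  | _, _, _, .andL₂ f => (cong_embRI_andL₂RI _).trans (.andL₂ (cong_embRI_focus f))
  | _, _, _, .andR f g => .andR (cong_embRI_focus f) (cong_embRI_focus g)
  | _, _, _, .orL f g =>
      (cong_embRI_orLRI _ _).trans (.orL (cong_embRI_focus f) (cong_embRI_focus g))
  | _, _, _, .orR₁ f =>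
      (cong_embRI_orR₁RI _).trans
        (.orR₁ (cong_embRI_focus f))
  | _, _, _, .orR₂ f =>
      (cong_embRI_orR₂RI _).trans
        (.orR₂ (cong_embRI_focus f))

/-! ### Focusing an embedded derivation -/

/-- The untagged version of a derivation in the focusing phase. -/
def Fo.untag {o : Option Tag} {S : Stoup At} {Γ : Cxt At} {P : Fma At} :
    Fo o S Γ P → Fo none S Γ P
  | .pass _ hP f => .pass (ann_none _) hP f
  | .andL₁ _ hP f => .andL₁ (ann_none _) hP f
  | .andL₂ _ hP f => .andL₂ (ann_none _) hP f
  | .ax _ => .ax (ann_none _)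
  | .IR _ => .IR (ann_none _)
  | .tensorR _ hT h hl f g => .tensorR (ann_none _) hT h hl f g
  | .orR₁ _ hT hl f => .orR₁ (ann_none _) hT hl f
  | .orR₂ _ hT hl f => .orR₂ (ann_none _) hT hl f

/-- The untagged version of a derivation in the left invertible phase. -/
def LI.untag {o : Option Tag} {S : Stoup At} {Γ : Cxt At} {P : Fma At} :
    LI o S Γ P → LI none S Γ P
  | .IL hP f => .IL hP f
  | .tensorL hP f => .tensorL hP f
  | .orL hP f g => .orL hP f g
  | .f2li hP hT f => .f2li hP hT f.untag

theorem Fo.untag_none {S : Stoup At} {Γ : Cxt At} {P : Fma At} :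
    (f : Fo none S Γ P) → f.untag = f
  | .pass _ _ _ => rfl
  | .andL₁ _ _ _ => rfl
  | .andL₂ _ _ _ => rfl
  | .ax _ => rfl
  | .IR _ => rfl
  | .tensorR _ _ _ _ _ _ => rfl
  | .orR₁ _ _ _ _ => rfl
  | .orR₂ _ _ _ _ => rfl

theorem LI.untag_none {S : Stoup At} {Γ : Cxt At} {P : Fma At} :
    (f : LI none S Γ P) → f.untag = f
  | .IL _ _ => rfl
  | .tensorL _ _ => rfl
  | .orL _ _ _ => rfl
  | .f2li _ _ f => congrArg _ f.untag_none

theorem Ann.eq {t s : Tag} (h : Ann (some t) s) : s = t :=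
  h.elim nofun fun e => (Option.some.inj e).symm

theorem Fo.exists_tagged_eq {t : Tag} {S : Stoup At} {Γ : Cxt At} {P : Fma At}
    (f : Fo (some t) S Γ P) :
    ∃ (g : Fo none S Γ P) (h : g.tag = t), h ▸ g.tagged = f ∧ f.untag = g := by
  cases f with
  | pass ho | andL₁ ho | andL₂ ho | ax ho | IR ho | tensorR ho | orR₁ ho | orR₂ ho =>
      obtain rfl := ho.eq
      exact ⟨Fo.untag _, rfl, rfl, rfl⟩

theorem tags_append {S : Stoup At} {Γ : Cxt At} : {Ps Qs : List (Fma At)} →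
    (fs : All (Fo none S Γ) Ps) → (gs : All (Fo none S Γ) Qs) →
      tags (fs.append gs) = tags fs ++ tags gs
  | _, _, .nil, _ => rfl
  | _, _, .cons _ fs, gs => congrArg _ (tags_append fs gs)

theorem tags_single {S : Stoup At} {Γ : Cxt At} : {P : Fma At} → (hP : P.NonNeg) →
    (f : Fo none S Γ P) → tags (.single hP f) = [f.tag]
  | .atom _, _, _ => rfl
  | .unit, _, _ => rfl
  | .tensor _ _, _, _ => rfl
  | .or _ _, _, _ => rfl

theorem andRStarT_append {T : Stoup At} {Γ : Cxt At} (hT : Irr T) {A B : Fma At}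
    (fs : All (Fo none T Γ) A.conj) (gs : All (Fo none T Γ) B.conj) {l : List Tag}
    (h : tags (Ps := (Fma.and A B).conj) (fs.append gs) = l) (h' : l = tags fs ++ tags gs) :
    h ▸ andRStarT hT (.and A B) (fs.append gs) =
      .andRT h' (andRStarT hT A fs) (andRStarT hT B gs) := by
  have key : ∀ fs' gs', fs' = fs → gs' = gs → ∀ h : l = tags fs' ++ tags gs',
      RI.andRT h (andRStarT hT A fs') (andRStarT hT B gs') =
        .andRT h' (andRStarT hT A fs) (andRStarT hT B gs) := by
    rintro _ _ rfl rfl _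
    rfl
  subst h
  exact key _ _ (All.fst_append fs gs) (All.snd_append fs gs) (tags_split A.conj _)

theorem andRStarT_single {T : Stoup At} {Γ : Cxt At} (hT : Irr T) : {P : Fma At} →
    (hP : P.NonNeg) → (f : Fo none T Γ P) → (h : tags (.single hP f) = [f.tag]) →
      h ▸ andRStarT hT P (.single hP f) = .li2riT hP (.f2li hP hT f.tagged)
  | .atom _, _, _, _ => rfl
  | .unit, _, _, _ => rfl
  | .tensor _ _, _, _, _ => rfl
  | .or _ _, _, _, _ => rfl

theorem genAll_f2li {A C : Fma At} {Δ : Cxt At} (r : RightRule A C Δ) {T : Stoup At}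
    {Γ Θ : Cxt At} (hT : Irr T) (hΘ : Θ = Γ ++ Δ) : {Qs : List (Fma At)} →
    (hA : A.conj = Qs) → (fs : All (Fo none T Γ) Qs) → (hl : Valid (tags fs)) →
      genAll r hΘ hA (fs.map fun _ f => .f2li f.nonNeg hT f) =
        .f2li r.nonNeg hT (r.fireAll hA hΘ hT fs hl)
  | _, hA, .nil, _ => absurd hA A.conj_ne_nil
  | _, hA, .cons f fs, hl => by
      rw [All.map, genAll, genLI, All.map_map,
        All.map_id (k := fun _ f => LI.invF hT (.f2li (Fo.nonNeg f) hT f)) (fun _ _ => rfl),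
        genFo_of_valid r hA hT hΘ f fs hl]

theorem RightRule.applyRI_eq {A C : Fma At} {Δ : Cxt At} (r : RightRule A C Δ) {T : Stoup At}
    {Γ Θ : Cxt At} (hT : Irr T) (hΘ : Θ = Γ ++ Δ) {f : RI none T Γ A}
    {fs : All (Fo none T Γ) A.conj} (hf : f.invert = fs.map fun _ f => .f2li f.nonNeg hT f)
    (hl : Valid (tags fs)) :
    r.applyRI hΘ f =
      .li2ri r.nonNeg (.f2li r.nonNeg hT (r.fire hT hl hΘ (andRStarT hT A fs))) := by
  rw [applyRI, hf, genAll_f2li r hT hΘ rfl fs hl]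
  rfl

mutual

theorem focus_embRI {S : Stoup At} {Γ : Cxt At} {A : Fma At} : (f : RI none S Γ A) →
    focus (embRI f) = f
  | .andR f g => by rw [embRI, focus, focus_embRI f, focus_embRI g]
  | .li2ri hP f => by rw [embRI, focus_embLI hP f, f.untag_none]
termination_by f => sizeOf f

theorem exists_andRStarT_eq {T : Stoup At} {Γ : Cxt At} (hT : Irr T) {A : Fma At}
    {l : List Tag} : (f : RI (some l) T Γ A) →
    ∃ (fs : All (Fo none T Γ) A.conj) (h : tags fs = l), h ▸ andRStarT hT A fs = f ∧
      (focus (embRI f)).invert = fs.map fun _ f => .f2li f.nonNeg hT f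
  | .andRT h f g => by
      obtain ⟨fs, rfl, rfl, hf⟩ := exists_andRStarT_eq hT f
      obtain ⟨gs, rfl, rfl, hg⟩ := exists_andRStarT_eq hT g
      refine ⟨fs.append gs, (tags_append fs gs).trans h.symm, andRStarT_append hT fs gs _ h, ?_⟩
      rw [All.map_append_conj, ← hf, ← hg]
      rfl
  | .li2riT hP (.f2li _ _ f) => by
      have ih := focus_embFo hP hT f
      obtain ⟨g, rfl, rfl, hg⟩ := f.exists_tagged_eq
      refine ⟨.single hP g, tags_single hP g, andRStarT_single hT hP g _, ?_⟩
      rw [hg] at ih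
      rw [All.map_single]
      exact (congrArg RI.invert ih).trans (by rw [RI.invert])
termination_by f => sizeOf f

theorem focus_embLI {o : Option Tag} {S : Stoup At} {Γ : Cxt At} {P : Fma At}
    (hP : P.NonNeg) : (f : LI o S Γ P) → focus (embLI f) = .li2ri hP f.untag
  | .IL _ f => by rw [embLI, focus, focus_embLI hP f, RI.ILRI, f.untag_none]; rfl
  | .tensorL _ f => by rw [embLI, focus, focus_embLI hP f, RI.tensorLRI, f.untag_none]; rfl
  | .orL _ f g => by
      rw [embLI, focus, focus_embLI hP f, focus_embLI hP g, RI.orLRI, f.untag_none,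
        g.untag_none]
      rfl
  | .f2li _ hT f => focus_embFo hP hT f
termination_by f => sizeOf f

theorem focus_embFo {o : Option Tag} : {T : Stoup At} → {Γ : Cxt At} → {P : Fma At} →
    (hP : P.NonNeg) → (hT : Irr T) → (f : Fo o T Γ P) →
      focus (embFo f) = .li2ri hP (.f2li hP hT f.untag)
  | _, _, _, hP, hT, .pass _ _ f => by rw [embFo, focus, focus_embLI hP f, RI.passRI, f.untag_none]; rfl
  | _, _, _, hP, hT, .andL₁ _ _ f => by rw [embFo, focus, focus_embLI hP f, RI.andL₁RI, f.untag_none]; rfl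
  | _, _, _, hP, hT, .andL₂ _ _ f => by rw [embFo, focus, focus_embLI hP f, RI.andL₂RI, f.untag_none]; rfl
  | _, _, _, hP, hT, .ax _ => rfl
  | _, _, _, hP, hT, .IR _ => rfl
  | _, _, _, hP, hT, .tensorR _ _ h hl f g => by
      obtain ⟨fs, rfl, rfl, hf⟩ := exists_andRStarT_eq hT f
      rw [embFo, focus, focus_embRI g]
      exact (RightRule.tensorR g).applyRI_eq hT h hf hl
  | _, _, _, hP, hT, .orR₁ _ _ hl f => by
      obtain ⟨fs, rfl, rfl, hf⟩ := exists_andRStarT_eq hT f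
      exact RightRule.orR₁.applyRI_eq hT (List.append_nil _).symm hf hl
  | _, _, _, hP, hT, .orR₂ _ _ hl f => by
      obtain ⟨fs, rfl, rfl, hf⟩ := exists_andRStarT_eq hT f
      exact RightRule.orR₂.applyRI_eq hT (List.append_nil _).symm hf hl
termination_by _ _ _ _ _ f => sizeOf f

end

end SkewAdd

theorem mainTheorem4 {At : Type u} (S : Stoup At) (Γ : Cxt At) (A : Fma At) :
    (∀ f g : Der S Γ A, Cong f g → focus f = focus g) ∧
    (∀ f : Der S Γ A, Cong (embRI (focus f)) f) ∧
    (∀ f : RI none S Γ A, focus (embRI f) = f) ∧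
    (∃ e : Quotient (congSetoid S Γ A) ≃ RI none S Γ A,
      (∀ f : Der S Γ A, e (Quotient.mk _ f) = focus f) ∧
      (∀ f : RI none S Γ A, e.symm f = Quotient.mk _ (embRI f))) ∧
    (∀ f : Der S Γ A, ∃! h : RI none S Γ A, Cong (embRI h) f) ∧
    (∀ f g : Der S Γ A, Cong f g ↔ focus f = focus g) := by
  have h₆ : ∀ f g : Der S Γ A, Cong f g ↔ focus f = focus g := fun f g =>
    ⟨focus_eq_of_cong, fun h =>
      (cong_embRI_focus f).symm.trans (h ▸ cong_embRI_focus g)⟩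
  refine ⟨fun _ _ => focus_eq_of_cong, cong_embRI_focus, focus_embRI,
    ⟨⟨Quotient.lift focus fun _ _ => focus_eq_of_cong, fun f => Quotient.mk _ (embRI f), ?_,
      focus_embRI⟩, fun _ => rfl, fun _ => rfl⟩, ?_, h₆⟩
  · rintro ⟨f⟩
    exact Quotient.sound (cong_embRI_focus f)
  · exact fun f => ⟨focus f, cong_embRI_focus f, fun h hh =>
      (focus_embRI h).symm.trans (focus_eq_of_cong hh)⟩
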